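/- Let $1<r\le 2$ and let $(\mathbb B,\|\cdot\|)$ be a separable (real) Banach space which is $r$-smooth, i.e. there is an equivalent norm $\|\cdot\|'$ on $\mathbb B$ such that $$\sup_{t>0}\ \sup_{\|x\|'=\|y\|'=1}\frac{\|x+ty\|'+\|x-ty\|'-2}{t^r}<\infty .$$ Let $1<p<r$. Then there is a constant $K=K(p,\mathbb B)\in(0,\infty)$, depending only on $p$ and $\mathbb B$, such that the following holds. Let $m\ge 2$ be an integer, let $(\xi_i)_{i\ge1}$ be an i.i.d. sequence, defined on a probability space, with values in a measurable space $(S,\mathcal S)$, and let $h\colon S^m\to\mathbb B$ be a measurable function such that $h(\xi_1,\dots,\xi_m)$ is integrable and, for every $\ell_0\in\{1,\dots,m\}$, $$\mathbb E\big[h(\xi_1,\dots,\xi_m)\,\big|\,(\xi_j)_{1\le j\le m,\ j\ne \ell_0}\big]=0\quad\text{a.s.}$$ For $n\ge m$ put $U_{m,n}(h)=\sum_{1\le i_1<\dots<i_m\le n}h(\xi_{i_1},\dots,\xi_{i_m})$. Then $$\sup_{t>0}t^p\,\mathbb P\Big(\sup_{n\ge m}\frac1{n^{m/p}}\|U_{m,n}(h)\|>t\Big)\le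 K\,\mathbb E\big[\|h(\xi_1,\dots,\xi_m)\|^p\big]$$ (where the right-hand side may be $+\infty$). Moreover, if $\mathbb E\big[\|h(\xi_1,\dots,\xi_m)\|^p\big]<\infty$, then $$\lim_{n\to\infty}\frac1{n^{m/p}}\|U_{m,n}(h)\|=0\quad\text{almost surely.}$$ -/

import Mathlib

open MeasureTheory ProbabilityTheory Filter Topology

/-- `B` is `r`-smooth: there is an equivalent norm `N` on `B` with
`sup_{t > 0} sup_{N x = N y = 1} (N (x + t y) + N (x - t y) - 2) / t ^ r < ∞`. -/
def IsRSmooth (B : Type*) [NormedAddCommGroup B] [NormedSpace ℝ B] (r : ℝ) : Prop :=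
  ∃ N : Seminorm ℝ B,
    (∃ c C : ℝ, 0 < c ∧ 0 < C ∧ ∀ x : B, c * ‖x‖ ≤ N x ∧ N x ≤ C * ‖x‖) ∧
    ∃ M : ℝ, ∀ t : ℝ, 0 < t → ∀ x y : B, N x = 1 → N y = 1 →
      (N (x + t • y) + N (x - t • y) - 2) / t ^ r ≤ M

/-- An i.i.d. sequence of `S`-valued random variables. -/
structure IsIIDSequence {Ω S : Type*} [MeasurableSpace Ω] [MeasurableSpace S]
    (ξ : ℕ → Ω → S) (μ : Measure Ω) : Prop where
  measurable : ∀ i, Measurable (ξ i)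
  indep : iIndepFun ξ μ
  identDistrib : ∀ i, IdentDistrib (ξ i) (ξ 0) μ μ

/-- The strictly increasing `m`-tuples with entries among the first `n` indices. Sequences are
numbered from `0`, so these indices are `0, …, n - 1`. -/
def incTuples (m n : ℕ) : Finset (Fin m → ℕ) :=
  (Fintype.piFinset fun _ : Fin m => Finset.range n).filter
    fun i => ∀ a b : Fin m, a < b → i a < i b

/-- The `U`-statistic of order `m` with kernel `h` based on the first `n` terms of `ξ`. -/
def uStat {Ω S B : Type*} [AddCommMonoid B] {m : ℕ} (h : (Fin m → S) → B)
    (ξ : ℕ → Ω → S) (n : ℕ) (ω : Ω) : B :=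
  ∑ i ∈ incTuples m n, h fun l => ξ (i l) ω

/-- The random variable `h(ξ_1, …, ξ_m)` (the first `m` terms of the sequence). -/
def kernelRV {Ω S B : Type*} {m : ℕ} (h : (Fin m → S) → B) (ξ : ℕ → Ω → S) (ω : Ω) : B :=
  h fun l => ξ l ω

/-- The σ-algebra generated by the first `m` terms of `ξ`, with the term of index `l₀` removed. -/
abbrev sigmaWithout {Ω S : Type*} [MeasurableSpace S] {m : ℕ} (ξ : ℕ → Ω → S) (l₀ : Fin m) :
    MeasurableSpace Ω :=
  MeasurableSpace.comap (fun ω (l : {l : Fin m // l ≠ l₀}) => ξ (l : Fin m) ω)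
    MeasurableSpace.pi

/-- The kernel `h` is degenerated with respect to `ξ`: the random variable `h(ξ_1, …, ξ_m)` is
integrable, and its conditional expectation given all but any one of `ξ_1, …, ξ_m` vanishes.
(Integrability is what makes the conditional expectation meaningful.) -/
def IsDegenerated {Ω S B : Type*} [MeasurableSpace Ω] [MeasurableSpace S]
    [NormedAddCommGroup B] [NormedSpace ℝ B] [CompleteSpace B] {m : ℕ}
    (h : (Fin m → S) → B) (ξ : ℕ → Ω → S) (μ : Measure Ω) : Prop :=
  Integrable (kernelRV h ξ) μ ∧
    ∀ l₀ : Fin m, μ[kernelRV h ξ | sigmaWithout ξ l₀] =ᵐ[μ] 0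

/-! An `r`-smooth norm yields a gauge φ comparable with ‖·‖^r such that φ(x+y) + φ(x-y) ≤ 2φ(x) +
κφ(y). For a centred d, Jensen gives φ(x) ≤ E φ(x-d), hence E φ(x+d) ≤ φ(x) + κ E φ(d): a martingale
difference costs only κ times its own gauge moment. Used one index at a time, this bounds the gauge
moment of a sum of degenerate terms (`integral_gauge_sum_powerset_le`); together with Doob's
inequality it controls the maximum of a martingale (`IsBddMartingaleDiff.measure_exists_le`).

Sort the terms of U by their largest index j. The resulting layers are martingale differences, to be
normalized by a_j = (j+1)^(m/p). In layer j, truncate h at t·a_j and recentre in every coordinate.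
The truncated part stays degenerate and is bounded, so its gauge moments are available; the
remainder is handled in L¹. Since layer j has C(j, m-1) terms, sums of powers of j bound the two
series by multiples of t^(r-p) E‖h‖^p and t^(1-p) E‖h‖^p (`exists_layer_decomposition`).

Doob's and Markov's inequalities then bound the maximum of the normalized partial sums at level t by
a multiple of t^(-p) E‖h‖^p, and summation by parts returns to U itself. The tails of the same two
series tend to zero, so Kronecker's lemma gives the almost sure limit.

The constant does not depend on m: each coordinate costs a fixed factor, but C(j, m-1) contributes
1/(m-1)!, and the product is bounded by an exponential (`pow_pred_mul_pow_div_factorial_le`). -/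

/-! ### Smooth gauges from smooth norms -/

/-- A convex continuous function comparable with `‖·‖ ^ r` and satisfying the two-point
smoothness inequality with constant `κ`. -/
structure IsSmoothGauge {B : Type*} [NormedAddCommGroup B] [NormedSpace ℝ B]
    (φ : B → ℝ) (r κ c C : ℝ) : Prop where
  r_pos : 0 < r
  κ_pos : 0 < κ
  c_pos : 0 < c
  C_pos : 0 < C
  convexOn : ConvexOn ℝ Set.univ φ
  continuous : Continuous φ
  smooth : ∀ x y, φ (x + y) + φ (x - y) ≤ 2 * φ x + κ * φ y
  lower : ∀ x, c * ‖x‖ ^ r ≤ φ x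
  upper : ∀ x, φ x ≤ C * ‖x‖ ^ r

/-- Bernoulli's inequality with exponent r-1 in [0,1], multiplied by 1+a, leaves the quadratic term
(r-1)a². -/
lemma rpow_one_add_le_quadratic {a r : ℝ} (ha : -1 ≤ a) (hr₁ : 1 ≤ r) (hr₂ : r ≤ 2) :
    (1 + a) ^ r ≤ 1 + r * a + a ^ 2 := by
  rcases eq_or_lt_of_le ha with rfl | ha'
  · rw [show (1 : ℝ) + -1 = 0 by norm_num, Real.zero_rpow (by linarith)]
    linarith
  have h0 : 0 < 1 + a := by linarith
  have h1 : (1 + a) ^ r = (1 + a) * (1 + a) ^ (r - 1) := by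
    rw [Real.rpow_sub_one h0.ne']
    field_simp
  have h2 := _root_.rpow_one_add_le_one_add_mul_self ha (p := r - 1) (by linarith) (by linarith)
  rw [h1]
  nlinarith [mul_le_mul_of_nonneg_left h2 h0.le, sq_nonneg a]

lemma Seminorm.convexOn_rpow {B : Type*} [AddCommGroup B] [Module ℝ B] (N : Seminorm ℝ B)
    {r : ℝ} (hr : 1 ≤ r) : ConvexOn ℝ Set.univ fun x => N x ^ r := by
  refine ⟨convex_univ, fun x _ y _ a b ha hb hab => ?_⟩
  have h1 : N (a • x + b • y) ≤ a * N x + b * N y := by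
    simpa using N.convexOn.2 (Set.mem_univ x) (Set.mem_univ y) ha hb hab
  calc N (a • x + b • y) ^ r ≤ (a * N x + b * N y) ^ r :=
        Real.rpow_le_rpow (apply_nonneg _ _) h1 (by linarith)
    _ ≤ a • N x ^ r + b • N y ^ r :=
        (_root_.convexOn_rpow hr).2 (apply_nonneg N x) (apply_nonneg N y) ha hb hab

/-- If N x ≤ N y, the triangle inequality suffices and costs 2·2^r. Otherwise scale to N x = 1 and
put t = N y / N x < 1. The quadratic bound applies to both N(x±y)/N x: the linear terms add up to at
most r·M·t^r ≤ 2M·t^r by smoothness, and the quadratic ones to 2t² ≤ 2t^r. -/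
lemma Seminorm.two_point_smooth {B : Type*} [AddCommGroup B] [Module ℝ B] (N : Seminorm ℝ B)
    {r M : ℝ} (hr₁ : 1 ≤ r) (hr₂ : r ≤ 2) (hM : 0 ≤ M)
    (h : ∀ t : ℝ, 0 < t → ∀ x y : B, N x = 1 → N y = 1 →
      (N (x + t • y) + N (x - t • y) - 2) / t ^ r ≤ M) (x y : B) :
    N (x + y) ^ r + N (x - y) ^ r ≤ 2 * N x ^ r + (2 * 2 ^ r + 2 * M + 2) * N y ^ r := by
  have hr0 : 0 ≤ r := by linarith
  have hx := apply_nonneg N x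
  have hy := apply_nonneg N y
  have hxr := Real.rpow_nonneg hx r
  have hyr := Real.rpow_nonneg hy r
  have hadd := map_add_le_add N x y
  have hsub : N (x - y) ≤ N x + N y := map_sub_le_add N x y
  by_cases hxy : N x ≤ N y
  · have e : (2 * N y) ^ r = 2 ^ r * N y ^ r := Real.mul_rpow (by norm_num) hy
    have h1 : N (x + y) ^ r ≤ (2 * N y) ^ r :=
      Real.rpow_le_rpow (apply_nonneg _ _) (by linarith) hr0
    have h2 : N (x - y) ^ r ≤ (2 * N y) ^ r :=
      Real.rpow_le_rpow (apply_nonneg _ _) (by linarith) hr0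
    nlinarith
  push Not at hxy
  have hx0 : 0 < N x := hy.trans_lt hxy
  rcases eq_or_lt_of_le hy with hy0 | hy0
  · rw [← hy0] at hadd hsub ⊢
    have h1 : N (x + y) ^ r ≤ N x ^ r := Real.rpow_le_rpow (apply_nonneg _ _) (by linarith) hr0
    have h2 : N (x - y) ^ r ≤ N x ^ r := Real.rpow_le_rpow (apply_nonneg _ _) (by linarith) hr0
    rw [Real.zero_rpow (by linarith)]
    linarith
  set ρ := N x with hρ
  set t := N y / ρ with ht
  have ht0 : 0 < t := by positivity
  have ht1 : t < 1 := (div_lt_one hx0).2 hxy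
  have hsm := h t ht0 (ρ⁻¹ • x) ((N y)⁻¹ • y)
    (by rw [map_smul_eq_mul, Real.norm_of_nonneg (by positivity), inv_mul_cancel₀ hx0.ne'])
    (by rw [map_smul_eq_mul, Real.norm_of_nonneg (by positivity), inv_mul_cancel₀ hy0.ne'])
  have e0 : t • (N y)⁻¹ • y = ρ⁻¹ • y := by
    rw [smul_smul, ht]; congr 1; field_simp
  rw [e0, ← smul_add, ← smul_sub, map_smul_eq_mul, map_smul_eq_mul,
    Real.norm_of_nonneg (by positivity : 0 ≤ ρ⁻¹), div_le_iff₀ (by positivity)] at hsm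
  have hback : ρ ≤ N (x - y) + N y := by simpa using map_add_le_add N (x - y) y
  have hback' : ρ ≤ N (x + y) + N y := by simpa using map_sub_le_add N (x + y) y
  have key : ∀ u : ℝ, ρ ≤ u + N y → u ≤ ρ + N y →
      (ρ⁻¹ * u) ^ r ≤ 1 + r * (ρ⁻¹ * u - 1) + t ^ 2 := by
    intro u h1 h2
    have h3 : -t ≤ ρ⁻¹ * u - 1 := by
      rw [ht, inv_mul_eq_div, neg_le_iff_add_nonneg, ← sub_nonneg]
      field_simp
      linarith
    have h4 : ρ⁻¹ * u - 1 ≤ t := by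
      rw [ht, inv_mul_eq_div, ← sub_nonneg]
      field_simp
      linarith
    have h5 := rpow_one_add_le_quadratic (a := ρ⁻¹ * u - 1) (by linarith) hr₁ hr₂
    rw [add_sub_cancel] at h5
    nlinarith
  have k1 := key _ hback' hadd
  have k2 := key _ hback hsub
  have ht2 : t ^ 2 ≤ t ^ r := by
    rw [← Real.rpow_two]
    exact Real.rpow_le_rpow_of_exponent_ge ht0 ht1.le hr₂
  have hsum : (ρ⁻¹ * N (x + y)) ^ r + (ρ⁻¹ * N (x - y)) ^ r ≤ 2 + (2 * M + 2) * t ^ r := by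
    have : 0 ≤ M * t ^ r := by positivity
    nlinarith
  have e1 : t ^ r = (ρ ^ r)⁻¹ * N y ^ r := by
    rw [ht, Real.div_rpow hy hx0.le]; field_simp
  rw [Real.mul_rpow (by positivity) (apply_nonneg _ _),
    Real.mul_rpow (by positivity) (apply_nonneg _ _), Real.inv_rpow hx0.le, e1] at hsum
  have hρr : 0 < ρ ^ r := by positivity
  have := mul_le_mul_of_nonneg_left hsum hρr.le
  field_simp at this
  have h2r : (0 : ℝ) ≤ 2 * 2 ^ r := by positivity
  nlinarith [mul_nonneg h2r hyr]

theorem IsRSmooth.exists_gauge {B : Type*} [NormedAddCommGroup B] [NormedSpace ℝ B] {r : ℝ}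
    (hB : IsRSmooth B r) (hr₁ : 1 < r) (hr₂ : r ≤ 2) :
    ∃ (φ : B → ℝ) (κ c C : ℝ), IsSmoothGauge φ r κ c C := by
  obtain ⟨N, ⟨c, C, hc, hC, hN⟩, M, hM⟩ := hB
  -- If B is trivial there are no unit vectors and M may be negative, hence `max M 0`.
  refine ⟨fun x => N x ^ r, 2 * 2 ^ r + 2 * max M 0 + 2, c ^ r, C ^ r, by linarith, ?_, by positivity,
    by positivity, N.convexOn_rpow hr₁.le, ?_, ?_, fun x => ?_, fun x => ?_⟩
  · have h1 : (0 : ℝ) ≤ 2 * 2 ^ r := by positivity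
    have h2 := le_max_right M 0
    linarith
  · have : Continuous N := by
      refine (LipschitzWith.of_le_add_mul' C fun x y => ?_).continuous
      have h1 := map_add_le_add N y (x - y)
      rw [add_sub_cancel] at h1
      rw [dist_eq_norm]
      exact h1.trans (add_le_add_right (hN _).2 _)
    exact this.rpow_const fun _ => Or.inr (by linarith)
  · exact N.two_point_smooth hr₁.le hr₂ (le_max_right _ _)
      fun t ht x y hx hy => (hM t ht x y hx hy).trans (le_max_left _ _)
  · rw [← Real.mul_rpow hc.le (norm_nonneg _)]
    exact Real.rpow_le_rpow (by positivity) (hN x).1 (by linarith)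
  · rw [← Real.mul_rpow hC.le (norm_nonneg _)]
    exact Real.rpow_le_rpow (apply_nonneg _ _) (hN x).2 (by linarith)

/-! ### Sums of powers by telescoping -/

/-- The difference is at least min(1,b)·k^(b-1): by Bernoulli for b ≤ 1, and by monotonicity in the
exponent for b ≥ 1. The factor 1 + 1/b dominates 1/min(1,b) in both cases. -/
lemma rpow_sub_one_le_sub {b k : ℝ} (hb : 0 < b) (hk : 1 ≤ k) :
    k ^ (b - 1) ≤ (1 + 1 / b) * (k ^ b - (k - 1) ^ b) := by
  have hk0 : 0 < k := by linarith
  have e : (k - 1) ^ b = k ^ b * (1 + -(1 / k)) ^ b := by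
    have hk1 : 1 / k ≤ 1 := (div_le_one hk0).2 hk
    rw [← Real.mul_rpow hk0.le (by linarith)]
    congr 1; field_simp; ring
  have e2 : k ^ b = k * k ^ (b - 1) := by rw [Real.rpow_sub_one hk0.ne']; field_simp
  have hkm : -1 ≤ -(1 / k) := by
    have hk1 : 1 / k ≤ 1 := (div_le_one hk0).2 hk
    linarith
  have hp : 0 < k ^ (b - 1) := by positivity
  have hbi : 0 < 1 / b := by positivity
  have hbb : 1 / b * b = 1 := by field_simp
  have hkk : k * (1 / k) = 1 := by field_simp
  have main : min 1 b * k ^ (b - 1) ≤ k ^ b - (k - 1) ^ b := by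
    have : (1 + -(1 / k)) ^ b ≤ 1 - min 1 b * (1 / k) := by
      rcases le_total 1 b with h | h
      · rw [min_eq_left h]
        have h0 : 0 ≤ 1 + -(1 / k) := by linarith
        rcases eq_or_lt_of_le h0 with h0 | h0
        · rw [← h0, Real.zero_rpow hb.ne']; linarith
        · calc (1 + -(1 / k)) ^ b ≤ (1 + -(1 / k)) ^ (1 : ℝ) :=
              Real.rpow_le_rpow_of_exponent_ge h0 (by
                have : 0 < 1 / k := by positivity
                linarith) h
            _ = _ := by rw [Real.rpow_one]; ring
      · rw [min_eq_right h]
        have := _root_.rpow_one_add_le_one_add_mul_self hkm hb.le h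
        linarith
    rw [e]
    have h2 := mul_le_mul_of_nonneg_left this (by positivity : 0 ≤ k ^ b)
    have h3 : k ^ b * (min 1 b * (1 / k)) = min 1 b * k ^ (b - 1) := by
      rw [e2]; linear_combination min 1 b * k ^ (b - 1) * hkk
    nlinarith
  have hmin : 1 ≤ (1 + 1 / b) * min 1 b := by
    rcases le_total 1 b with h | h
    · rw [min_eq_left h]; linarith
    · rw [min_eq_right h]; nlinarith
  calc k ^ (b - 1) ≤ ((1 + 1 / b) * min 1 b) * k ^ (b - 1) := le_mul_of_one_le_left hp.le hmin
    _ = (1 + 1 / b) * (min 1 b * k ^ (b - 1)) := by ring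
    _ ≤ _ := by gcongr

lemma sum_rpow_lt_le {b x : ℝ} (hb : 0 < b) (hx : 0 ≤ x) (n : ℕ) :
    ∑ j ∈ Finset.range n, (if (j : ℝ) + 1 < x then ((j : ℝ) + 1) ^ (b - 1) else 0)
      ≤ (1 + 1 / b) * x ^ b := by
  have hb' : 0 < 1 + 1 / b := by positivity
  -- With min(n,x)^b on the right the induction telescopes while n+1 < x, and is plain monotonicity
  -- afterwards.
  suffices h : ∑ j ∈ Finset.range n, (if (j : ℝ) + 1 < x then ((j : ℝ) + 1) ^ (b - 1) else 0)
      ≤ (1 + 1 / b) * (min (n : ℝ) x) ^ b by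
    refine h.trans ?_
    gcongr
    exact min_le_right _ _
  induction n with
  | zero => simp [hx, Real.zero_rpow hb.ne']
  | succ n ih =>
    rw [Finset.sum_range_succ]
    push_cast
    split_ifs with h
    · rw [min_eq_left (by linarith)] at ih ⊢
      have := rpow_sub_one_le_sub hb (k := n + 1) (by linarith [n.cast_nonneg (α := ℝ)])
      rw [add_sub_cancel_right] at this
      linarith
    · rw [add_zero]
      refine ih.trans ?_
      gcongr
      linarith

/-- Writing k^(-a) as (k+1)^(-a) times exp(a·log((k+1)/k)), this is e^u ≥ 1+u together with
log((k+1)/k) ≥ 1/(k+1). -/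
lemma rpow_neg_sub_one_le_sub {a k : ℝ} (ha : 0 < a) (hk : 0 < k) :
    (k + 1) ^ (-a - 1) ≤ 1 / a * (k ^ (-a) - (k + 1) ^ (-a)) := by
  have hk1 : 0 < k + 1 := by linarith
  have e : k ^ (-a) = (k + 1) ^ (-a) * Real.exp (a * -Real.log (k / (k + 1))) := by
    rw [Real.rpow_def_of_pos hk, Real.rpow_def_of_pos hk1, ← Real.exp_add,
      Real.log_div hk.ne' hk1.ne']
    congr 1; ring
  have h1 : 1 / (k + 1) ≤ -Real.log (k / (k + 1)) := by
    have := Real.log_le_sub_one_of_pos (div_pos hk hk1)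
    have e : k / (k + 1) - 1 = -(1 / (k + 1)) := by field_simp; ring
    linarith
  have h2 : 1 + a * (1 / (k + 1)) ≤ Real.exp (a * -Real.log (k / (k + 1))) := by
    have := Real.add_one_le_exp (a * -Real.log (k / (k + 1)))
    have := mul_le_mul_of_nonneg_left h1 ha.le
    linarith
  have e3 : (k + 1) ^ (-a - 1) = (k + 1) ^ (-a) * (1 / (k + 1)) := by
    rw [Real.rpow_sub_one hk1.ne']; ring
  have hp : 0 < (k + 1) ^ (-a) := by positivity
  rw [e, e3, div_mul_eq_mul_div, le_div_iff₀ ha]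
  nlinarith [mul_le_mul_of_nonneg_left h2 hp.le]

lemma sum_rpow_ge_le {a x : ℝ} (ha : 0 < a) (hx : 0 < x) (n : ℕ) :
    ∑ j ∈ Finset.range n, (if x ≤ (j : ℝ) + 1 then ((j : ℝ) + 1) ^ (-a - 1) else 0)
      ≤ (1 + 1 / a) * x ^ (-a) := by
  have hai : 0 < 1 / a := by positivity
  -- The 1 in 1 + 1/a pays for the first nonzero term; the later ones telescope against
  -- (1/a)·n^(-a).
  suffices h : ∑ j ∈ Finset.range n, (if x ≤ (j : ℝ) + 1 then ((j : ℝ) + 1) ^ (-a - 1) else 0)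
      ≤ if (n : ℝ) < x then 0 else (1 + 1 / a) * x ^ (-a) - 1 / a * (n : ℝ) ^ (-a) by
    refine h.trans ?_
    split_ifs
    · positivity
    · have : 0 ≤ 1 / a * (n : ℝ) ^ (-a) := by positivity
      linarith
  induction n with
  | zero => simp [hx]
  | succ n ih =>
    rw [Finset.sum_range_succ]
    push_cast
    by_cases h : x ≤ (n : ℝ) + 1
    · rw [if_pos h, if_neg (by linarith)]
      split_ifs at ih with h'
      · have hn : (0 : ℝ) < n + 1 := by linarith
        have h1 : ((n : ℝ) + 1) ^ (-a - 1) ≤ ((n : ℝ) + 1) ^ (-a) :=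
          Real.rpow_le_rpow_of_exponent_le (by linarith [n.cast_nonneg (α := ℝ)]) (by linarith)
        have h2 : ((n : ℝ) + 1) ^ (-a) ≤ x ^ (-a) :=
          Real.rpow_le_rpow_of_nonpos hx h (by linarith)
        nlinarith
      · have hn : (0 : ℝ) < n := by linarith
        have := rpow_neg_sub_one_le_sub ha hn
        linarith
    · rw [if_neg h, if_pos (by linarith), add_zero]
      rw [if_pos (by linarith)] at ih
      exact ih

namespace IsSmoothGauge

variable {B : Type*} [NormedAddCommGroup B] [NormedSpace ℝ B] {φ : B → ℝ} {r κ c C : ℝ}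

lemma nonneg (hφ : IsSmoothGauge φ r κ c C) (x : B) : 0 ≤ φ x :=
  (mul_nonneg hφ.c_pos.le (Real.rpow_nonneg (norm_nonneg _) _)).trans (hφ.lower x)

lemma map_zero (hφ : IsSmoothGauge φ r κ c C) : φ 0 = 0 :=
  le_antisymm (by simpa [Real.zero_rpow hφ.r_pos.ne'] using hφ.upper 0) (hφ.nonneg 0)

end IsSmoothGauge

/-! ### Product measures and averaging over one coordinate -/

/-- Bounded measurable functions. -/
def IsBddMeasurable {α B : Type*} [MeasurableSpace α] [NormedAddCommGroup B] [MeasurableSpace B]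
    (f : α → B) : Prop :=
  Measurable f ∧ ∃ b : ℝ, ∀ x, ‖f x‖ ≤ b

/-- `f` does not depend on the coordinate `i`. -/
def InvariantAt {ι S γ : Type*} [DecidableEq ι] (i : ι) (f : (ι → S) → γ) : Prop :=
  ∀ x s, f (Function.update x i s) = f x

/-- The function `f` averaged over the coordinate `i`. -/
noncomputable def coordAvg {ι S B : Type*} [DecidableEq ι] [MeasurableSpace S]
    [NormedAddCommGroup B] [NormedSpace ℝ B] (P : Measure S) (i : ι) (f : (ι → S) → B) :
    (ι → S) → B :=
  fun x => ∫ s, f (Function.update x i s) ∂P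

/-- The law of an i.i.d. family with marginal law `P`. -/
noncomputable abbrev iidMeasure (ι : Type*) {S : Type*} [MeasurableSpace S] (P : Measure S) :
    Measure (ι → S) :=
  Measure.infinitePi fun _ : ι => P

/-- Resampling one coordinate independently keeps the product law, as seen on finite boxes. With
Fubini this lets `coordAvg` play the role of conditional expectation given the other coordinates. -/
lemma measurePreserving_update {ι S : Type*} [DecidableEq ι] [MeasurableSpace S] (P : Measure S)
    [IsProbabilityMeasure P] (i : ι) :
    MeasurePreserving (fun q : (ι → S) × S => Function.update q.1 i q.2)
      ((iidMeasure ι P).prod P) (iidMeasure ι P) := by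
  refine ⟨measurable_update', Measure.eq_infinitePi _ fun s t ht => ?_⟩
  rw [Measure.map_apply measurable_update' (.pi s.countable_toSet fun _ _ => ht _)]
  by_cases hi : i ∈ s
  · have : (fun q : (ι → S) × S => Function.update q.1 i q.2) ⁻¹' ((s : Set ι).pi t)
        = (((s.erase i : Finset ι) : Set ι).pi t) ×ˢ (t i) := by
      ext ⟨x, u⟩
      simp only [Set.mem_preimage, Set.mem_pi, Set.mem_prod, Finset.mem_coe, Finset.mem_erase]
      constructor
      · intro h
        refine ⟨fun j hj => ?_, by simpa using h i hi⟩
        simpa [hj.1] using h j hj.2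
      · rintro ⟨h1, h2⟩ j hj
        by_cases hji : j = i
        · subst hji; simpa using h2
        · simpa [hji] using h1 j ⟨hji, hj⟩
    rw [this, Measure.prod_prod, Measure.infinitePi_pi _ fun i _ => ht i,
      Finset.prod_erase_mul _ _ hi]
  · have : (fun q : (ι → S) × S => Function.update q.1 i q.2) ⁻¹' ((s : Set ι).pi t)
        = ((s : Set ι).pi t) ×ˢ Set.univ := by
      ext ⟨x, u⟩
      simp only [Set.mem_preimage, Set.mem_pi, Set.mem_prod, Finset.mem_coe, Set.mem_univ,
        and_true]
      refine forall₂_congr fun j hj => ?_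
      rw [Function.update_of_ne (by rintro rfl; exact hi hj)]
    rw [this, Measure.prod_prod, Measure.infinitePi_pi _ fun i _ => ht i, measure_univ, mul_one]

lemma integrable_comp_update {ι S B : Type*} [DecidableEq ι] [MeasurableSpace S] (P : Measure S)
    [IsProbabilityMeasure P] [NormedAddCommGroup B] (i : ι) {f : (ι → S) → B}
    (hf : Integrable f (iidMeasure ι P)) :
    Integrable (fun q : (ι → S) × S => f (Function.update q.1 i q.2))
      ((iidMeasure ι P).prod P) :=
  ((measurePreserving_update P i).integrable_comp hf.aestronglyMeasurable).2 hf

lemma integral_coordAvg {ι S B : Type*} [DecidableEq ι] [MeasurableSpace S] (P : Measure S)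
    [IsProbabilityMeasure P] [NormedAddCommGroup B] [NormedSpace ℝ B] (i : ι) {f : (ι → S) → B}
    (hf : Integrable f (iidMeasure ι P)) :
    ∫ x, coordAvg P i f x ∂(iidMeasure ι P) = ∫ x, f x ∂(iidMeasure ι P) := by
  have hmp := measurePreserving_update P i
  have h2 := integral_map hmp.aemeasurable (f := f) (by rw [hmp.map_eq]; exact hf.1)
  rw [hmp.map_eq, integral_prod _ (integrable_comp_update P i hf)] at h2
  exact h2.symm

namespace IsBddMeasurable

variable {α β B : Type*} [MeasurableSpace α] [MeasurableSpace β] [NormedAddCommGroup B]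
  [MeasurableSpace B] {f g : α → B}

lemma comp (hf : IsBddMeasurable f) {u : β → α} (hu : Measurable u) :
    IsBddMeasurable fun x => f (u x) :=
  ⟨hf.1.comp hu, hf.2.imp fun _ h _ => h _⟩

lemma const (b : B) : IsBddMeasurable fun _ : α => b := ⟨measurable_const, ‖b‖, fun _ => le_rfl⟩

lemma zero : IsBddMeasurable fun _ : α => (0 : B) := ⟨measurable_const, 0, by simp⟩

lemma indicator (hf : IsBddMeasurable f) {T : Set α} (hT : MeasurableSet T) :
    IsBddMeasurable (T.indicator f) := by
  obtain ⟨b, hb⟩ := hf.2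
  exact ⟨hf.1.indicator hT, b, fun x => (norm_indicator_le_norm_self f x).trans (hb x)⟩

variable [BorelSpace B] [SecondCountableTopology B]

lemma add (hf : IsBddMeasurable f) (hg : IsBddMeasurable g) :
    IsBddMeasurable fun x => f x + g x := by
  obtain ⟨b, hb⟩ := hf.2
  obtain ⟨b', hb'⟩ := hg.2
  exact ⟨hf.1.add hg.1, b + b', fun x => (norm_add_le _ _).trans (add_le_add (hb x) (hb' x))⟩

lemma sub (hf : IsBddMeasurable f) (hg : IsBddMeasurable g) :
    IsBddMeasurable fun x => f x - g x := by
  obtain ⟨b, hb⟩ := hf.2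
  obtain ⟨b', hb'⟩ := hg.2
  exact ⟨hf.1.sub hg.1, b + b', fun x => (norm_sub_le _ _).trans (add_le_add (hb x) (hb' x))⟩

lemma sum {ι : Type*} {F : ι → α → B} (A : Finset ι) (h : ∀ i ∈ A, IsBddMeasurable (F i)) :
    IsBddMeasurable fun x => ∑ i ∈ A, F i x := by
  classical
  induction A using Finset.induction_on with
  | empty => simpa using zero
  | insert a A ha ih =>
    simp only [Finset.sum_insert ha]
    exact (h a (by simp)).add (ih fun i hi => h i (by simp [hi]))

lemma const_smul [NormedSpace ℝ B] (hf : IsBddMeasurable f) (a : ℝ) :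
    IsBddMeasurable fun x => a • f x := by
  obtain ⟨b, hb⟩ := hf.2
  exact ⟨hf.1.const_smul a, ‖a‖ * b, fun x => by rw [norm_smul]; gcongr; exact hb x⟩

lemma stronglyMeasurable (hf : IsBddMeasurable f) : StronglyMeasurable f := hf.1.stronglyMeasurable

lemma integrable (hf : IsBddMeasurable f) (μ : Measure α) [IsFiniteMeasure μ] : Integrable f μ := by
  obtain ⟨b, hb⟩ := hf.2
  exact Integrable.of_bound hf.stronglyMeasurable.aestronglyMeasurable b (ae_of_all _ hb)

lemma norm_rpow (hf : IsBddMeasurable f) {r : ℝ} (hr : 0 ≤ r) :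
    IsBddMeasurable fun x => ‖f x‖ ^ r := by
  obtain ⟨b, hb⟩ := hf.2
  refine ⟨hf.1.norm.pow_const r, b ^ r, fun x => ?_⟩
  rw [Real.norm_of_nonneg (by positivity)]
  exact Real.rpow_le_rpow (norm_nonneg _) (hb x) hr

lemma gauge [NormedSpace ℝ B] {φ : B → ℝ} {r κ c C : ℝ} (hf : IsBddMeasurable f)
    (hφ : IsSmoothGauge φ r κ c C) :
    IsBddMeasurable fun x => φ (f x) := by
  obtain ⟨b, hb⟩ := hf.2
  refine ⟨hφ.continuous.measurable.comp hf.1, C * b ^ r, fun x => ?_⟩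
  rw [Real.norm_of_nonneg (hφ.nonneg _)]
  exact (hφ.upper _).trans (mul_le_mul_of_nonneg_left
    (Real.rpow_le_rpow (norm_nonneg _) (hb x) hφ.r_pos.le) hφ.C_pos.le)

end IsBddMeasurable

/-! ### Adding a centred term under the gauge -/

section

variable {ι S B : Type*} [DecidableEq ι] [MeasurableSpace S] (P : Measure S)
  [IsProbabilityMeasure P] [NormedAddCommGroup B] [NormedSpace ℝ B]
  [MeasurableSpace B] [BorelSpace B] [SecondCountableTopology B]

lemma measurable_coordAvg (i : ι) {f : (ι → S) → B} (hf : Measurable f) :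
    Measurable (coordAvg P i f) :=
  ((hf.comp (measurable_update' (a := i))).stronglyMeasurable.integral_prod_right'
    (ν := P)).measurable

lemma IsBddMeasurable.coordAvg {f : (ι → S) → B} (hf : IsBddMeasurable f) (i : ι) :
    IsBddMeasurable (coordAvg P i f) := by
  obtain ⟨b, hb⟩ := hf.2
  refine ⟨measurable_coordAvg P i hf.1, b, fun x => ?_⟩
  exact (norm_integral_le_of_norm_le_const (ae_of_all P fun s => hb _)).trans (by simp)

lemma IsBddMeasurable.update {f : (ι → S) → B} (hf : IsBddMeasurable f) (x : ι → S)
    (i : ι) :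
    IsBddMeasurable fun s => f (Function.update x i s) :=
  hf.comp (measurable_update x)

variable {φ : B → ℝ} {r κ c C : ℝ}

lemma IsSmoothGauge.le_integral_add [CompleteSpace B] (hφ : IsSmoothGauge φ r κ c C) (x : B)
    {d : S → B} (hd : IsBddMeasurable d) (hd0 : ∫ s, d s ∂P = 0) :
    φ x ≤ ∫ s, φ (x + d s) ∂P := by
  have hb : IsBddMeasurable fun s => x + d s := (IsBddMeasurable.const x).add hd
  have := hφ.convexOn.map_integral_le (μ := P) (f := fun s => x + d s) hφ.continuous.continuousOn
    isClosed_univ (by simp) (hb.integrable P) ((hb.gauge hφ).integrable P)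
  rwa [integral_add (integrable_const x) (hd.integrable P), hd0, integral_const, probReal_univ,
    one_smul, add_zero] at this

/-- Integrate the smoothness inequality and subtract Jensen's inequality for -d; this removes one of
the two copies of φ(x). -/
lemma IsSmoothGauge.integral_add_le [CompleteSpace B] (hφ : IsSmoothGauge φ r κ c C) (x : B)
    {d : S → B} (hd : IsBddMeasurable d) (hd0 : ∫ s, d s ∂P = 0) :
    ∫ s, φ (x + d s) ∂P ≤ φ x + κ * ∫ s, φ (d s) ∂P := by
  have hc : IsBddMeasurable fun _ : S => x := .const x
  have hneg : IsBddMeasurable fun s => -d s := by simpa using IsBddMeasurable.zero.sub hd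
  have h1 := hφ.le_integral_add P x hneg (by rw [integral_neg, hd0, neg_zero])
  simp only [← sub_eq_add_neg] at h1
  have i1 := ((hc.add hd).gauge hφ).integrable P
  have i2 := ((hc.sub hd).gauge hφ).integrable P
  have i3 := (hd.gauge hφ).integrable P
  have h2 : ∫ s, (φ (x + d s) + φ (x - d s)) ∂P ≤ ∫ s, (2 * φ x + κ * φ (d s)) ∂P :=
    integral_mono (i1.add i2) ((integrable_const _).add (i3.const_mul κ)) fun s => hφ.smooth _ _
  rw [integral_add i1 i2, integral_add (integrable_const _) (i3.const_mul κ), integral_const,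
    probReal_univ, one_smul, integral_const_mul] at h2
  linarith

variable [CompleteSpace B] {X D : (ι → S) → B} {i : ι}

lemma coordAvg_gauge_add_le (hφ : IsSmoothGauge φ r κ c C) (hX : InvariantAt i X)
    (hD : IsBddMeasurable D) (hD0 : ∀ x, coordAvg P i D x = 0) (x : ι → S) :
    coordAvg P i (fun x => φ (X x + D x)) x
      ≤ φ (X x) + κ * coordAvg P i (fun x => φ (D x)) x := by
  simp only [coordAvg, hX x]
  exact hφ.integral_add_le P (X x) (hD.update x i) (hD0 x)

lemma le_coordAvg_gauge_add (hφ : IsSmoothGauge φ r κ c C) (hX : InvariantAt i X)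
    (hD : IsBddMeasurable D) (hD0 : ∀ x, coordAvg P i D x = 0) (x : ι → S) :
    φ (X x) ≤ coordAvg P i (fun x => φ (X x + D x)) x := by
  simp only [coordAvg, hX x]
  exact hφ.le_integral_add P (X x) (hD.update x i) (hD0 x)

lemma integral_gauge_add_le (hφ : IsSmoothGauge φ r κ c C) (hXb : IsBddMeasurable X)
    (hX : InvariantAt i X) (hD : IsBddMeasurable D) (hD0 : ∀ x, coordAvg P i D x = 0) :
    ∫ x, φ (X x + D x) ∂(iidMeasure ι P)
      ≤ ∫ x, φ (X x) ∂(iidMeasure ι P) + κ * ∫ x, φ (D x) ∂(iidMeasure ι P) := by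
  have b1 := (hXb.add hD).gauge hφ
  have b2 := hXb.gauge hφ
  have b3 := hD.gauge hφ
  rw [← integral_coordAvg P i (b1.integrable _), ← integral_coordAvg P i (b3.integrable _),
    ← integral_const_mul, ← integral_add (b2.integrable _)
      (((b3.coordAvg P i).integrable _).const_mul κ)]
  exact integral_mono ((b1.coordAvg P i).integrable _)
    ((b2.integrable _).add (((b3.coordAvg P i).integrable _).const_mul κ))
    (coordAvg_gauge_add_le P hφ hX hD hD0)

/-- The indicator of an event that ignores coordinate i passes through the average over i, so
pointwise Jensen applies on the event. This is the submartingale property used for Doob's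
inequality. -/
lemma setIntegral_gauge_le (hφ : IsSmoothGauge φ r κ c C) (hXb : IsBddMeasurable X)
    (hX : InvariantAt i X) (hD : IsBddMeasurable D) (hD0 : ∀ x, coordAvg P i D x = 0)
    {T : Set (ι → S)} (hT : MeasurableSet T) (hTi : InvariantAt i (· ∈ T)) :
    ∫ x in T, φ (X x) ∂(iidMeasure ι P) ≤ ∫ x in T, φ (X x + D x) ∂(iidMeasure ι P) := by
  have b1 := ((hXb.add hD).gauge hφ).indicator hT
  have b2 := (hXb.gauge hφ).indicator hT
  rw [← integral_indicator hT, ← integral_indicator hT, ← integral_coordAvg P i (b1.integrable _)]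
  refine integral_mono (b2.integrable _) ((b1.coordAvg P i).integrable _) fun x => ?_
  have hTx : ∀ s, (Function.update x i s ∈ T) = (x ∈ T) := hTi x
  by_cases hx : x ∈ T
  · simpa [coordAvg, Set.indicator, hTx, hx] using le_coordAvg_gauge_add P hφ hX hD hD0 x
  · simp [coordAvg, Set.indicator, hTx, hx]

end

lemma coordAvg_sum {ι S B κ : Type*} [DecidableEq ι] [MeasurableSpace S] {P : Measure S}
    [IsProbabilityMeasure P] [NormedAddCommGroup B] [NormedSpace ℝ B] [MeasurableSpace B]
    [BorelSpace B] [SecondCountableTopology B] {i : ι} (A : Finset κ) {F : κ → (ι → S) → B}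
    (h : ∀ a ∈ A, IsBddMeasurable (F a)) (x : ι → S) :
    coordAvg P i (fun x => ∑ a ∈ A, F a x) x = ∑ a ∈ A, coordAvg P i (F a) x :=
  integral_finsetSum _ fun a ha => ((h a ha).update x i).integrable P

/-- Moment inequality for a sum of completely degenerate functions indexed by finite sets. -/
theorem integral_gauge_sum_powerset_le {S B : Type*} [MeasurableSpace S] (P : Measure S)
    [IsProbabilityMeasure P] [NormedAddCommGroup B] [NormedSpace ℝ B] [CompleteSpace B]
    [MeasurableSpace B] [BorelSpace B] [SecondCountableTopology B]
    {φ : B → ℝ} {r κ c C : ℝ} (hφ : IsSmoothGauge φ r κ c C) (n : ℕ)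
    (F : Finset ℕ → (ℕ → S) → B) (hF : ∀ A, IsBddMeasurable (F A))
    (hF0 : ∀ A ⊆ Finset.range n, ∀ i < n, i ∈ A → ∀ x, coordAvg P i (F A) x = 0)
    (hFi : ∀ A ⊆ Finset.range n, ∀ i < n, i ∉ A → InvariantAt i (F A)) :
    ∫ x, φ (∑ A ∈ (Finset.range n).powerset, F A x) ∂(iidMeasure ℕ P)
      ≤ ∑ A ∈ (Finset.range n).powerset, κ ^ A.card * ∫ x, φ (F A x) ∂(iidMeasure ℕ P) := by
  induction n generalizing F with
  | zero => simp
  | succ n ih =>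
    have hn : n ∉ Finset.range n := Finset.notMem_range_self
    simp only [Finset.range_add_one, Finset.sum_powerset_insert hn] at hF0 hFi ⊢
    have hsub : ∀ {A}, A ⊆ Finset.range n → insert n A ⊆ insert n (Finset.range n) :=
      fun hA => Finset.insert_subset_insert _ hA
    have hsub' : ∀ {A}, A ⊆ Finset.range n → A ⊆ insert n (Finset.range n) :=
      fun hA => hA.trans (Finset.subset_insert _ _)
    have hnot : ∀ {A : Finset ℕ}, A ⊆ Finset.range n → n ∉ A := fun hA h => hn (hA h)
    -- Subsets avoiding n give a sum independent of coordinate n, those containing n a sum centred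
    -- in it. The induction hypothesis then applies to both families, the second indexed by A ↦
    -- `insert n A`.
    refine (integral_gauge_add_le P (i := n) hφ (IsBddMeasurable.sum _ fun A _ => hF A)
      (fun x s => Finset.sum_congr rfl fun A hA => ?_) (IsBddMeasurable.sum _ fun A _ => hF _)
      fun x => ?_).trans ?_
    · rw [Finset.mem_powerset] at hA
      exact hFi A (hsub' hA) n n.lt_succ_self (hnot hA) x s
    · rw [coordAvg_sum _ fun A _ => hF _]
      exact Finset.sum_eq_zero fun A hA =>
        hF0 _ (hsub (Finset.mem_powerset.1 hA)) n n.lt_succ_self (Finset.mem_insert_self _ _) x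
    have h1 := ih F hF (fun A hA i hi => hF0 A (hsub' hA) i (hi.trans n.lt_succ_self))
      (fun A hA i hi => hFi A (hsub' hA) i (hi.trans n.lt_succ_self))
    have h2 := ih (fun A => F (insert n A)) (fun A => hF _)
      (fun A hA i hi hiA => hF0 _ (hsub hA) i (hi.trans n.lt_succ_self)
        (Finset.mem_insert_of_mem hiA))
      (fun A hA i hi hiA => hFi _ (hsub hA) i (hi.trans n.lt_succ_self) (by
        rw [Finset.mem_insert, not_or]; exact ⟨hi.ne, hiA⟩))
    refine (add_le_add h1 (mul_le_mul_of_nonneg_left h2 hφ.κ_pos.le)).trans_eq ?_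
    rw [Finset.mul_sum]
    congr 1
    refine Finset.sum_congr rfl fun A hA => ?_
    rw [Finset.card_insert_of_notMem (hnot (Finset.mem_powerset.1 hA)), pow_succ]
    ring

/-! ### Martingales on sequence space and Doob's inequality -/

/-- The filtration on sequence space whose `n`-th term consists of the events that depend only on
the coordinates below `n`. -/
def coordFiltration (S : Type*) [MeasurableSpace S] :
    Filtration ℕ (MeasurableSpace.pi : MeasurableSpace (ℕ → S)) where
  seq n :=
    { MeasurableSet' := fun s => MeasurableSet s ∧ ∀ i, n ≤ i → InvariantAt i (· ∈ s)
      measurableSet_empty := ⟨MeasurableSet.empty, fun _ _ _ _ => rfl⟩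
      measurableSet_compl := fun s hs =>
        ⟨hs.1.compl, fun i hi x u => congrArg Not (hs.2 i hi x u)⟩
      measurableSet_iUnion := fun s hs =>
        ⟨MeasurableSet.iUnion fun k => (hs k).1, fun i hi x u => by
          simp only [Set.mem_iUnion, eq_iff_iff]
          exact exists_congr fun k => Eq.to_iff ((hs k).2 i hi x u)⟩ }
  mono' := fun _ _ hnk _ hs => ⟨hs.1, fun i hi => hs.2 i (hnk.trans hi)⟩
  le' := fun _ _ hs => hs.1

lemma measurable_coordFiltration {S γ : Type*} [MeasurableSpace S] [MeasurableSpace γ] {n : ℕ}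
    {f : (ℕ → S) → γ} (hf : Measurable f) (hi : ∀ i, n ≤ i → InvariantAt i f) :
    Measurable[coordFiltration S n] f := by
  intro s hs
  refine ⟨hf hs, fun i hin x u => ?_⟩
  simp only [Set.mem_preimage, hi i hin x u]

section

variable {S B : Type*} [MeasurableSpace S] (P : Measure S) [IsProbabilityMeasure P]
  [NormedAddCommGroup B] [NormedSpace ℝ B] [CompleteSpace B]
  [MeasurableSpace B] [BorelSpace B] [SecondCountableTopology B]
  {φ : B → ℝ} {r κ c C : ℝ} {d : ℕ → (ℕ → S) → B}

/-- Bounded martingale differences on sequence space. -/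
structure IsBddMartingaleDiff (d : ℕ → (ℕ → S) → B) : Prop where
  bdd : ∀ j, IsBddMeasurable (d j)
  invariant : ∀ j i, j < i → InvariantAt i (d j)
  coordAvg_eq_zero : ∀ j x, coordAvg P j (d j) x = 0

variable {P}

lemma IsBddMartingaleDiff.invariant_sum (hd : IsBddMartingaleDiff P d) {n i : ℕ} (hi : n ≤ i) :
    InvariantAt i fun x => ∑ j ∈ Finset.range n, d j x :=
  fun x s => Finset.sum_congr rfl fun j hj =>
    hd.invariant j i ((Finset.mem_range.1 hj).trans_le hi) x s

lemma IsBddMartingaleDiff.bdd_sum (hd : IsBddMartingaleDiff P d) (n : ℕ) :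
    IsBddMeasurable fun x => ∑ j ∈ Finset.range n, d j x :=
  IsBddMeasurable.sum _ fun j _ => hd.bdd j

lemma IsBddMartingaleDiff.integral_gauge_sum_le (hd : IsBddMartingaleDiff P d)
    (hφ : IsSmoothGauge φ r κ c C) (n : ℕ) :
    ∫ x, φ (∑ j ∈ Finset.range n, d j x) ∂(iidMeasure ℕ P)
      ≤ κ * ∑ j ∈ Finset.range n, ∫ x, φ (d j x) ∂(iidMeasure ℕ P) := by
  induction n with
  | zero => simp [hφ.map_zero]
  | succ n ih =>
    simp only [Finset.sum_range_succ]
    have := integral_gauge_add_le P hφ (hd.bdd_sum n) (hd.invariant_sum le_rfl) (hd.bdd n)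
      (hd.coordAvg_eq_zero n)
    linarith

lemma IsBddMartingaleDiff.submartingale (hd : IsBddMartingaleDiff P d)
    (hφ : IsSmoothGauge φ r κ c C) :
    Submartingale (fun n x => φ (∑ j ∈ Finset.range n, d j x)) (coordFiltration S)
      (iidMeasure ℕ P) := by
  refine submartingale_of_setIntegral_le_succ (fun n => ?_)
    (fun n => ((hd.bdd_sum n).gauge hφ).integrable _) fun n s hs => ?_
  · refine Measurable.stronglyMeasurable (measurable_coordFiltration ((hd.bdd_sum n).gauge hφ).1
      fun i hi x u => ?_)
    exact congrArg φ (hd.invariant_sum hi x u)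
  · simp only [Finset.sum_range_succ]
    exact setIntegral_gauge_le P hφ (hd.bdd_sum n) (hd.invariant_sum le_rfl) (hd.bdd n)
      (hd.coordAvg_eq_zero n) hs.1 (hs.2 n le_rfl)

/-- Maximal inequality for martingales in a smooth Banach space. -/
theorem IsBddMartingaleDiff.measure_exists_le (hd : IsBddMartingaleDiff P d)
    (hφ : IsSmoothGauge φ r κ c C) {W ε : ℝ} (hε : 0 < ε)
    (hW : ∀ n, ∑ j ∈ Finset.range n, ∫ x, φ (d j x) ∂(iidMeasure ℕ P) ≤ W) :
    iidMeasure ℕ P {x | ∃ n, ε ≤ ‖∑ j ∈ Finset.range n, d j x‖}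
      ≤ ENNReal.ofReal (κ * W / (c * ε ^ r)) := by
  have hcε : 0 < c * ε ^ r := mul_pos hφ.c_pos (Real.rpow_pos_of_pos hε r)
  have hE : {x | ∃ n, ε ≤ ‖∑ j ∈ Finset.range n, d j x‖}
      ⊆ ⋃ N : ℕ, {x | ∃ n ≤ N, c * ε ^ r ≤ φ (∑ j ∈ Finset.range n, d j x)} := by
    rintro x ⟨n, hn⟩
    refine Set.mem_iUnion.2 ⟨n, n, le_rfl, (mul_le_mul_of_nonneg_left ?_ hφ.c_pos.le).trans
      (hφ.lower _)⟩
    exact Real.rpow_le_rpow hε.le hn hφ.r_pos.le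
  refine (measure_mono hE).trans ?_
  have hmono : Monotone fun N : ℕ =>
      {x | ∃ n ≤ N, c * ε ^ r ≤ φ (∑ j ∈ Finset.range n, d j x)} :=
    fun N N' h x ⟨n, hn, hx⟩ => ⟨n, hn.trans h, hx⟩
  rw [hmono.measure_iUnion]
  refine iSup_le fun N => ?_
  obtain ⟨q, hq⟩ : ∃ q : NNReal, (q : ℝ) = c * ε ^ r := ⟨⟨c * ε ^ r, hcε.le⟩, rfl⟩
  -- Doob's inequality up to time N; the bound does not depend on N, so it passes to the increasing
  -- union.
  have hmax := maximal_ineq (hd.submartingale hφ) (fun n x => hφ.nonneg _)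
    (ε := q) N
  have hset : {x | ∃ n ≤ N, c * ε ^ r ≤ φ (∑ j ∈ Finset.range n, d j x)}
      = {x | (q : ℝ) ≤ (Finset.range (N + 1)).sup'
          Finset.nonempty_range_add_one fun n => φ (∑ j ∈ Finset.range n, d j x)} := by
    ext x
    simp [Finset.le_sup'_iff, hq]
  rw [hset, ENNReal.ofReal_div_of_pos hcε,
    ENNReal.le_div_iff_mul_le (Or.inl (by simpa using hcε)) (Or.inl ENNReal.ofReal_ne_top),
    mul_comm]
  have e : ENNReal.ofReal (c * ε ^ r) = (q : ENNReal) := by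
    rw [← hq, ENNReal.ofReal_coe_nnreal]
  rw [e]
  refine hmax.trans (ENNReal.ofReal_le_ofReal ?_)
  refine (setIntegral_le_integral (((hd.bdd_sum N).gauge hφ).integrable _)
    (ae_of_all _ fun x => hφ.nonneg _)).trans ?_
  exact (hd.integral_gauge_sum_le hφ N).trans (mul_le_mul_of_nonneg_left (hW N) hφ.κ_pos.le)

/-- Dropping the first terms preserves martingale differences. -/
lemma IsBddMartingaleDiff.tail (hd : IsBddMartingaleDiff P d) (N : ℕ) :
    IsBddMartingaleDiff P fun j x => if N ≤ j then d j x else 0 := by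
  refine ⟨fun j => ?_, fun j i hij x s => ?_, fun j x => ?_⟩
  · by_cases h : N ≤ j
    · simpa [h] using hd.bdd j
    · simpa [h] using IsBddMeasurable.zero
  · simp only [hd.invariant j i hij x s]
  · by_cases h : N ≤ j
    · simpa [h] using hd.coordAvg_eq_zero j x
    · simp [h, coordAvg]

end

/-! ### Recentring, coordinate by coordinate -/

/-- `f` recentred with respect to the coordinate `k`. -/
noncomputable def centerAt {ι S B : Type*} [DecidableEq ι] [MeasurableSpace S]
    [NormedAddCommGroup B] [NormedSpace ℝ B] (P : Measure S) (k : ι) (f : (ι → S) → B) :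
    (ι → S) → B :=
  fun x => f x - coordAvg P k f x

/-- `f` recentred successively with respect to the coordinates in the list `l`. -/
noncomputable def centerList {ι S B : Type*} [DecidableEq ι] [MeasurableSpace S]
    [NormedAddCommGroup B] [NormedSpace ℝ B] (P : Measure S) (l : List ι) (f : (ι → S) → B) :
    (ι → S) → B :=
  l.foldr (centerAt P) f

section

variable {ι S B : Type*} [DecidableEq ι] [MeasurableSpace S] (P : Measure S)
  [IsProbabilityMeasure P] [NormedAddCommGroup B] [NormedSpace ℝ B]

lemma integrable_coordAvg (i : ι) {f : (ι → S) → B} (hf : Integrable f (iidMeasure ι P)) :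
    Integrable (coordAvg P i f) (iidMeasure ι P) :=
  (integrable_comp_update P i hf).integral_prod_left

lemma invariantAt_coordAvg (i : ι) (f : (ι → S) → B) : InvariantAt i (coordAvg P i f) := by
  intro x s
  simp only [coordAvg, Function.update_idem]

variable [MeasurableSpace B] [BorelSpace B] [SecondCountableTopology B]

lemma IsBddMeasurable.centerAt {f : (ι → S) → B} (hf : IsBddMeasurable f) (k : ι) :
    IsBddMeasurable (centerAt P k f) :=
  hf.sub (hf.coordAvg P k)

lemma IsBddMeasurable.centerList {f : (ι → S) → B} (hf : IsBddMeasurable f) (l : List ι) :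
    IsBddMeasurable (centerList P l f) := by
  induction l with
  | nil => exact hf
  | cons k l ih => exact ih.centerAt P k

/-- Averages over distinct coordinates commute by Fubini, so recentring in k does not spoil centring
in l. Hence successive recentring ends centred in every listed coordinate. -/
lemma coordAvg_centerAt_of_ne {f : (ι → S) → B} (hf : IsBddMeasurable f) {k l : ι} (hkl : k ≠ l)
    (h0 : ∀ x, coordAvg P l f x = 0) (x : ι → S) : coordAvg P l (centerAt P k f) x = 0 := by
  have h1 : coordAvg P l (centerAt P k f) x
      = coordAvg P l f x - coordAvg P l (coordAvg P k f) x :=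
    integral_sub ((hf.update x l).integrable P) (((hf.coordAvg P k).update x l).integrable P)
  rw [h1, h0, zero_sub, neg_eq_zero]
  have hm : Measurable fun q : S × S => Function.update (Function.update x l q.1) k q.2 :=
    (measurable_update' (a := k)).comp (((measurable_update x).comp measurable_fst).prodMk
      measurable_snd)
  have h2 := integral_integral_swap (μ := P) (ν := P)
    (f := fun s u => f (Function.update (Function.update x l s) k u))
    ((hf.comp hm).integrable (P.prod P))
  rw [show coordAvg P l (coordAvg P k f) x
    = ∫ s, ∫ u, f (Function.update (Function.update x l s) k u) ∂P ∂P from rfl, h2]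
  refine integral_eq_zero_of_ae (ae_of_all _ fun u => ?_)
  simp only [Function.update_comm hkl.symm]
  exact h0 _

variable [CompleteSpace B]

lemma coordAvg_centerAt_self {f : (ι → S) → B} (hf : IsBddMeasurable f) (k : ι) (x : ι → S) :
    coordAvg P k (centerAt P k f) x = 0 := by
  have h : ∀ s, centerAt P k f (Function.update x k s)
      = f (Function.update x k s) - coordAvg P k f x := fun s => by
    rw [centerAt, invariantAt_coordAvg P k f x s]
  simp only [coordAvg] at h ⊢
  simp only [h]
  rw [integral_sub ((hf.update x k).integrable P) (integrable_const _), integral_const,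
    probReal_univ, one_smul, sub_self]

lemma coordAvg_centerList {f : (ι → S) → B} (hf : IsBddMeasurable f) (l : List ι) {i : ι}
    (hi : i ∈ l) (x : ι → S) : coordAvg P i (centerList P l f) x = 0 := by
  induction l generalizing x with
  | nil => simp at hi
  | cons k l ih =>
    by_cases hik : i = k
    · subst hik
      exact coordAvg_centerAt_self P (hf.centerList P l) i x
    · exact coordAvg_centerAt_of_ne P (hf.centerList P l) (Ne.symm hik)
        (ih (List.mem_of_ne_of_mem hik hi)) x

/-- From (u+v)^r ≤ 2^(r-1)(u^r + v^r), Jensen for the average, and invariance of the integral under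
averaging. -/
lemma integral_norm_centerAt_rpow_le {f : (ι → S) → B} (hf : IsBddMeasurable f) (k : ι) {r : ℝ}
    (hr : 1 ≤ r) :
    ∫ x, ‖centerAt P k f x‖ ^ r ∂(iidMeasure ι P)
      ≤ 2 ^ r * ∫ x, ‖f x‖ ^ r ∂(iidMeasure ι P) := by
  have hr0 : 0 ≤ r := by linarith
  have b1 := hf.norm_rpow hr0
  have b2 := b1.coordAvg P k
  have hconv := (normSeminorm ℝ B).convexOn_rpow hr
  have hj : ∀ x, ‖coordAvg P k f x‖ ^ r ≤ coordAvg P k (fun x => ‖f x‖ ^ r) x := fun x =>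
    hconv.map_integral_le (μ := P) (f := fun s => f (Function.update x k s))
      ((continuous_norm.rpow_const fun _ => Or.inr hr0).continuousOn) isClosed_univ (by simp)
      ((hf.update x k).integrable P) ((b1.update x k).integrable P)
  have hpt : ∀ x, ‖centerAt P k f x‖ ^ r
      ≤ 2 ^ r / 2 * (‖f x‖ ^ r + coordAvg P k (fun x => ‖f x‖ ^ r) x) := fun x => by
    have h1 : ‖centerAt P k f x‖ ^ r ≤ (‖f x‖ + ‖coordAvg P k f x‖) ^ r :=
      Real.rpow_le_rpow (norm_nonneg _) (norm_sub_le _ _) hr0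
    have h2 : (‖f x‖ + ‖coordAvg P k f x‖) ^ r
        ≤ 2 ^ (r - 1) * (‖f x‖ ^ r + ‖coordAvg P k f x‖ ^ r) :=
      mod_cast NNReal.rpow_add_le_mul_rpow_add_rpow ‖f x‖₊ ‖coordAvg P k f x‖₊ hr
    have h3 : (2 : ℝ) ^ (r - 1) = 2 ^ r / 2 := Real.rpow_sub_one two_ne_zero r
    rw [h3] at h2
    refine h1.trans (h2.trans ?_)
    gcongr
    exact hj x
  refine (integral_mono (((hf.centerAt P k).norm_rpow hr0).integrable _)
    (((b1.integrable _).add (b2.integrable _)).const_mul _) hpt).trans_eq ?_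
  rw [integral_const_mul, integral_add' (b1.integrable _) (b2.integrable _),
    integral_coordAvg P k (b1.integrable _)]
  ring

lemma integral_norm_centerList_rpow_le {f : (ι → S) → B} (hf : IsBddMeasurable f) (l : List ι)
    {r : ℝ} (hr : 1 ≤ r) :
    ∫ x, ‖centerList P l f x‖ ^ r ∂(iidMeasure ι P)
      ≤ (2 ^ r) ^ l.length * ∫ x, ‖f x‖ ^ r ∂(iidMeasure ι P) := by
  induction l with
  | nil => simp [centerList]
  | cons k l ih =>
    refine (integral_norm_centerAt_rpow_le P (hf.centerList P l) k hr).trans ?_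
    rw [List.length_cons, pow_succ', mul_assoc]
    gcongr

/-- Since h is already centred in k, the difference is h-f recentred in k. Thus recentring the
truncation keeps it L¹-close to h, at the cost of a factor 2. -/
lemma integral_norm_sub_centerAt_le {h f : (ι → S) → B} (hh : Integrable h (iidMeasure ι P))
    (hf : IsBddMeasurable f) {k : ι} (h0 : coordAvg P k h =ᵐ[iidMeasure ι P] 0) :
    ∫ x, ‖h x - centerAt P k f x‖ ∂(iidMeasure ι P)
      ≤ 2 * ∫ x, ‖h x - f x‖ ∂(iidMeasure ι P) := by
  have hi : Integrable (fun x => h x - f x) (iidMeasure ι P) := hh.sub (hf.integrable _)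
  have hpt : ∀ᵐ x ∂(iidMeasure ι P), ‖h x - centerAt P k f x‖
      ≤ ‖h x - f x‖ + coordAvg P k (fun x => ‖h x - f x‖) x := by
    filter_upwards [h0, (integrable_comp_update P k hh).prod_right_ae] with x hx hxi
    have e : h x - centerAt P k f x
        = (h x - f x) - ∫ s, (h (Function.update x k s) - f (Function.update x k s)) ∂P := by
      have hx' : ∫ s, h (Function.update x k s) ∂P = 0 := hx
      rw [integral_sub hxi ((hf.update x k).integrable P), hx', centerAt, coordAvg]
      abel
    rw [e]
    exact (norm_sub_le _ _).trans (add_le_add le_rfl (norm_integral_le_integral_norm _))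
  refine (integral_mono_ae (hh.sub ((hf.centerAt P k).integrable _)).norm
    (hi.norm.add (integrable_coordAvg P k hi.norm)) hpt).trans_eq ?_
  rw [integral_add' hi.norm (integrable_coordAvg P k hi.norm), integral_coordAvg P k hi.norm]
  ring

lemma integral_norm_sub_centerList_le {h f : (ι → S) → B} (hh : Integrable h (iidMeasure ι P))
    (hf : IsBddMeasurable f) (l : List ι)
    (h0 : ∀ k ∈ l, coordAvg P k h =ᵐ[iidMeasure ι P] 0) :
    ∫ x, ‖h x - centerList P l f x‖ ∂(iidMeasure ι P)
      ≤ 2 ^ l.length * ∫ x, ‖h x - f x‖ ∂(iidMeasure ι P) := by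
  induction l with
  | nil => simp [centerList]
  | cons k l ih =>
    refine (integral_norm_sub_centerAt_le P hh (hf.centerList P l) (h0 k (by simp))).trans ?_
    rw [List.length_cons, pow_succ', mul_assoc]
    gcongr
    exact ih fun j hj => h0 j (by simp [hj])

end

/-! ### Layers of a U-statistic -/

/-- The kernel `g` evaluated at the coordinates of `x` indexed by `A`, in increasing order. -/
def onSubset {S B : Type*} [Zero B] {m : ℕ} (g : (Fin m → S) → B) (A : Finset ℕ) (x : ℕ → S) : B :=
  if hA : A.card = m then g fun l => x (A.orderEmbOfFin hA l) else 0

/-- The part of the `U`-statistic whose largest index is `j`. -/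
def layer {S B : Type*} [AddCommMonoid B] {m : ℕ} (g : (Fin m → S) → B) (j : ℕ) (x : ℕ → S) : B :=
  ∑ A ∈ (Finset.range j).powerset, onSubset g (insert j A) x

lemma mem_incTuples {m n : ℕ} {i : Fin m → ℕ} :
    i ∈ incTuples m n ↔ (∀ l, i l < n) ∧ StrictMono i := by
  simp [incTuples, StrictMono]

/-- An increasing tuple is the increasing enumeration of its image. Sets of the wrong size
contribute 0, so the sum may run over a full powerset, which splits well when an index is added. -/
lemma uStat_eq_sum_onSubset {Ω S B : Type*} [AddCommMonoid B] {m : ℕ} (h : (Fin m → S) → B)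
    (ξ : ℕ → Ω → S) (n : ℕ) (ω : Ω) :
    uStat h ξ n ω = ∑ A ∈ (Finset.range n).powerset, onSubset h A fun i => ξ i ω := by
  have h1 : ∑ A ∈ Finset.powersetCard m (Finset.range n), onSubset h A (fun i => ξ i ω)
      = ∑ A ∈ (Finset.range n).powerset, onSubset h A fun i => ξ i ω := by
    refine Finset.sum_subset (fun A hA => Finset.mem_powerset.2 (Finset.mem_powersetCard.1 hA).1)
      fun A hA hA' => dif_neg fun hc => hA' ?_
    exact Finset.mem_powersetCard.2 ⟨Finset.mem_powerset.1 hA, hc⟩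
  have hcard : ∀ i ∈ incTuples m n, (Finset.univ.image i).card = m := fun i hi => by
    rw [Finset.card_image_of_injective _ (mem_incTuples.1 hi).2.injective, Finset.card_univ,
      Fintype.card_fin]
  have hemb : ∀ i (hi : i ∈ incTuples m n),
      i = (Finset.univ.image i).orderEmbOfFin (hcard i hi) := fun i hi =>
    Finset.orderEmbOfFin_unique _ (fun l => Finset.mem_image_of_mem _ (Finset.mem_univ l))
      (mem_incTuples.1 hi).2
  rw [← h1, uStat]
  refine Finset.sum_bij (fun i _ => Finset.univ.image i) (fun i hi => ?_) (fun i hi i' hi' e => ?_)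
    (fun A hA => ?_) fun i hi => ?_
  · refine Finset.mem_powersetCard.2 ⟨fun k hk => ?_, hcard i hi⟩
    obtain ⟨l, -, rfl⟩ := Finset.mem_image.1 hk
    exact Finset.mem_range.2 ((mem_incTuples.1 hi).1 l)
  · rw [hemb i hi, hemb i' hi']
    simp only [e]
  · obtain ⟨hA1, hA2⟩ := Finset.mem_powersetCard.1 hA
    refine ⟨A.orderEmbOfFin hA2, mem_incTuples.2 ⟨fun l => ?_, (A.orderEmbOfFin hA2).strictMono⟩,
      A.image_orderEmbOfFin_univ hA2⟩
    exact Finset.mem_range.1 (hA1 (A.orderEmbOfFin_mem hA2 l))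
  · rw [onSubset, dif_pos (hcard i hi)]
    congr 1
    funext l
    rw [← congrFun (hemb i hi) l]

lemma uStat_eq_sum_layer {Ω S B : Type*} [AddCommMonoid B] {m : ℕ} (hm : m ≠ 0)
    (h : (Fin m → S) → B) (ξ : ℕ → Ω → S) (n : ℕ) (ω : Ω) :
    uStat h ξ n ω = ∑ j ∈ Finset.range n, layer h j fun i => ξ i ω := by
  rw [uStat_eq_sum_onSubset]
  induction n with
  -- The empty set contributes nothing because m ≠ 0.
  | zero => simp [onSubset, hm.symm]
  | succ n ih =>
    rw [Finset.sum_range_succ, ← ih, Finset.range_add_one,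
      Finset.sum_powerset_insert Finset.notMem_range_self, layer]

lemma sum_powerset_range_ite_card {j m : ℕ} (hm : m ≠ 0) (a : ℝ) :
    ∑ A ∈ (Finset.range j).powerset, (if (insert j A).card = m then a else 0)
      = (j.choose (m - 1) : ℝ) * a := by
  have : ∀ A ∈ (Finset.range j).powerset, (if (insert j A).card = m then a else 0)
      = if A.card = m - 1 then a else 0 := fun A hA => by
    have hj : j ∉ A := fun h => Finset.notMem_range_self (Finset.mem_powerset.1 hA h)
    rw [Finset.card_insert_of_notMem hj]
    congr 1
    rw [eq_iff_iff]
    omega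
  rw [Finset.sum_congr rfl this, ← Finset.sum_filter, ← Finset.powersetCard_eq_filter,
    Finset.sum_const, Finset.card_powersetCard, Finset.card_range, nsmul_eq_mul]

lemma layer_smul {S B : Type*} [AddCommGroup B] [Module ℝ B] {m : ℕ} (g : (Fin m → S) → B)
    (a : ℝ) (j : ℕ) (x : ℕ → S) : layer (fun y => a • g y) j x = a • layer g j x := by
  simp only [layer, Finset.smul_sum, onSubset, smul_dite, smul_zero]

lemma layer_add {S B : Type*} [AddCommGroup B] {m : ℕ} (f g : (Fin m → S) → B)
    (j : ℕ) (x : ℕ → S) : layer (fun y => f y + g y) j x = layer f j x + layer g j x := by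
  simp only [layer, ← Finset.sum_add_distrib]
  refine Finset.sum_congr rfl fun A _ => ?_
  unfold onSubset
  split_ifs <;> simp

lemma invariantAt_onSubset {S B : Type*} [Zero B] {m : ℕ} (g : (Fin m → S) → B) {A : Finset ℕ}
    {i : ℕ} (hi : i ∉ A) : InvariantAt i (onSubset g A) := by
  intro x s
  unfold onSubset
  split_ifs with hA
  · congr 1
    funext l
    rw [Function.update_of_ne]
    rintro rfl
    exact hi (A.orderEmbOfFin_mem hA l)
  · rfl

lemma invariantAt_layer {S B : Type*} [AddCommMonoid B] {m : ℕ} (g : (Fin m → S) → B) {j i : ℕ}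
    (hi : j < i) : InvariantAt i (layer g j) := by
  intro x s
  refine Finset.sum_congr rfl fun A hA => invariantAt_onSubset g (fun h => ?_) x s
  rcases Finset.mem_insert.1 h with h | h
  · exact hi.ne' h
  · exact (hi.trans (Finset.mem_range.1 (Finset.mem_powerset.1 hA h))).false

section

variable {S B : Type*} [MeasurableSpace S] (P : Measure S) [IsProbabilityMeasure P] {m : ℕ}

lemma measurePreserving_orderEmb {A : Finset ℕ} (hA : A.card = m) :
    MeasurePreserving (fun (x : ℕ → S) l => x (A.orderEmbOfFin hA l)) (iidMeasure ℕ P)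
      (iidMeasure (Fin m) P) :=
  ⟨by fun_prop, Measure.map_infinitePi_infinitePi_of_inj (A.orderEmbOfFin hA).injective⟩

variable [NormedAddCommGroup B] [NormedSpace ℝ B] [MeasurableSpace B] {g : (Fin m → S) → B}

lemma IsBddMeasurable.onSubset (hg : IsBddMeasurable g) (A : Finset ℕ) :
    IsBddMeasurable (onSubset g A) := by
  by_cases hA : A.card = m
  · have : _root_.onSubset g A = fun x => g fun l => x (A.orderEmbOfFin hA l) := by
      funext x; exact dif_pos hA
    rw [this]
    exact hg.comp (by fun_prop)
  · have : _root_.onSubset g A = fun x => 0 := by funext x; exact dif_neg hA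
    rw [this]
    exact .zero

lemma coordAvg_onSubset (hg0 : ∀ l x, coordAvg P l g x = 0) {A : Finset ℕ} {i : ℕ} (hi : i ∈ A)
    (x : ℕ → S) : coordAvg P i (onSubset g A) x = 0 := by
  by_cases hA : A.card = m
  · obtain ⟨l, rfl⟩ : ∃ l, A.orderEmbOfFin hA l = i := by
      rw [← Set.mem_range, A.range_orderEmbOfFin hA]; exact hi
    have : ∀ s, onSubset g A (Function.update x (A.orderEmbOfFin hA l) s)
        = g (Function.update (fun l => x (A.orderEmbOfFin hA l)) l s) := fun s => by
      rw [onSubset, dif_pos hA]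
      exact congrArg g (Function.update_comp_eq_of_injective x
        (A.orderEmbOfFin hA).injective l s)
    simp only [coordAvg, this]
    exact hg0 l _
  · simp [coordAvg, onSubset, hA]

lemma integral_onSubset (hg : Measurable g) {ψ : B → ℝ} (hψ : Measurable ψ) (hψ0 : ψ 0 = 0)
    (A : Finset ℕ) :
    ∫ x, ψ (onSubset g A x) ∂(iidMeasure ℕ P)
      = if A.card = m then ∫ y, ψ (g y) ∂(iidMeasure (Fin m) P) else 0 := by
  split_ifs with hA
  · have hmp := measurePreserving_orderEmb P hA
    rw [← hmp.map_eq, integral_map (f := fun y => ψ (g y)) hmp.aemeasurable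
      (hψ.comp hg).stronglyMeasurable.aestronglyMeasurable]
    simp only [onSubset, hA, dif_pos]
  · simp [onSubset, hA, hψ0]

lemma integrable_onSubset (hg : Integrable g (iidMeasure (Fin m) P)) (A : Finset ℕ) :
    Integrable (onSubset g A) (iidMeasure ℕ P) := by
  by_cases hA : A.card = m
  · have : onSubset g A = fun x => g fun l => x (A.orderEmbOfFin hA l) := by
      funext x; exact dif_pos hA
    rw [this]
    exact ((measurePreserving_orderEmb P hA).integrable_comp hg.1).2 hg
  · have : onSubset g A = fun x => 0 := by funext x; exact dif_neg hA
    rw [this]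
    exact integrable_zero _ _ _

variable [BorelSpace B] [SecondCountableTopology B]

lemma integrable_layer (hg : Integrable g (iidMeasure (Fin m) P)) (j : ℕ) :
    Integrable (layer g j) (iidMeasure ℕ P) :=
  integrable_finsetSum _ fun _ _ => integrable_onSubset P hg _

lemma integral_norm_layer_le (hm : m ≠ 0) (hgm : Measurable g)
    (hg : Integrable g (iidMeasure (Fin m) P)) (j : ℕ) :
    ∫ x, ‖layer g j x‖ ∂(iidMeasure ℕ P)
      ≤ j.choose (m - 1) * ∫ y, ‖g y‖ ∂(iidMeasure (Fin m) P) := by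
  have hi : ∀ A ∈ (Finset.range j).powerset,
      Integrable (fun x => ‖onSubset g (insert j A) x‖) (iidMeasure ℕ P) :=
    fun A _ => (integrable_onSubset P hg _).norm
  refine (integral_mono (integrable_layer P hg j).norm (integrable_finsetSum _ hi)
    fun x => norm_sum_le _ _).trans_eq ?_
  rw [integral_finsetSum _ hi, ← sum_powerset_range_ite_card hm]
  exact Finset.sum_congr rfl fun A _ => integral_onSubset P hgm measurable_norm norm_zero _

/-- The kernel may change with the layer because the truncation level does. -/
lemma isBddMartingaleDiff_layer {g : ℕ → (Fin m → S) → B} (hg : ∀ j, IsBddMeasurable (g j))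
    (hg0 : ∀ j l x, coordAvg P l (g j) x = 0) :
    IsBddMartingaleDiff P fun j => layer (g j) j := by
  refine ⟨fun j => IsBddMeasurable.sum _ fun A _ => (hg j).onSubset _,
    fun j i => invariantAt_layer (g j), fun j x => ?_⟩
  refine (coordAvg_sum _ (fun A _ => (hg j).onSubset _) x).trans ?_
  exact Finset.sum_eq_zero fun A _ =>
    coordAvg_onSubset P (hg0 j) (Finset.mem_insert_self _ _) x

/-- The largest index j is common to all terms, so the powerset inequality is used only for the
other m-1 indices. This explains κ^(m-1); one more κ is paid in the maximal inequality. -/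
lemma integral_gauge_layer_le [CompleteSpace B] {φ : B → ℝ} {r κ c C : ℝ}
    (hφ : IsSmoothGauge φ r κ c C) (hm : m ≠ 0) (hg : IsBddMeasurable g)
    (hg0 : ∀ l x, coordAvg P l g x = 0) (j : ℕ) :
    ∫ x, φ (layer g j x) ∂(iidMeasure ℕ P)
      ≤ j.choose (m - 1) * (κ ^ (m - 1) * ∫ y, φ (g y) ∂(iidMeasure (Fin m) P)) := by
  refine (integral_gauge_sum_powerset_le P hφ j (fun A => onSubset g (insert j A))
    (fun A => hg.onSubset _)
    (fun A _ i _ hi => coordAvg_onSubset P hg0 (Finset.mem_insert_of_mem hi))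
    fun A _ i hij hi => invariantAt_onSubset g ?_).trans_eq ?_
  · rw [Finset.mem_insert, not_or]
    exact ⟨hij.ne, hi⟩
  rw [← sum_powerset_range_ite_card hm]
  refine Finset.sum_congr rfl fun A hA => ?_
  rw [integral_onSubset P hg.1 hφ.continuous.measurable hφ.map_zero]
  split_ifs with h
  · rw [Finset.card_insert_of_notMem
      fun h => Finset.notMem_range_self (Finset.mem_powerset.1 hA h)] at h
    rw [show m - 1 = A.card by omega]
  · rw [mul_zero]

end

/-! ### Normalization and truncation -/

/-- The normalizing sequence, `n ^ (m / p)` with `n = j + 1`. -/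
noncomputable def normalizer (m : ℕ) (p : ℝ) (j : ℕ) : ℝ := ((j : ℝ) + 1) ^ ((m : ℝ) / p)

lemma normalizer_pos (m : ℕ) (p : ℝ) (j : ℕ) : 0 < normalizer m p j := by
  unfold normalizer; positivity

lemma choose_pred_le (m j : ℕ) (hm : m ≠ 0) :
    (j.choose (m - 1) : ℝ) ≤ ((m - 1).factorial : ℝ)⁻¹ * ((j : ℝ) + 1) ^ ((m : ℝ) - 1) := by
  have h1 : (j.choose (m - 1) : ℝ) ≤ (j : ℝ) ^ (m - 1) / (m - 1).factorial :=
    Nat.choose_le_pow_div _ _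
  have h2 : ((j : ℝ) + 1) ^ ((m : ℝ) - 1) = ((j : ℝ) + 1) ^ (m - 1) := by
    rw [← Real.rpow_natCast, Nat.cast_sub (Nat.one_le_iff_ne_zero.2 hm), Nat.cast_one]
  rw [h2, inv_mul_eq_div]
  refine h1.trans ?_
  gcongr
  linarith

/-- Truncation is active exactly for j+1 < x = (y/t)^(p/m), where the terms are of order (j+1)^(b-1)
with b = m - m/p. The sum is of order x^b, and x^b·y = t^(1-p)·y^p. As b ≥ 1 - 1/p, the factor 1 +
1/b is bounded uniformly in m. -/
lemma sum_choose_mul_large_le {m : ℕ} (hm : m ≠ 0) {p t y : ℝ} (hp : 1 < p) (ht : 0 < t)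
    (hy : 0 ≤ y) (n : ℕ) :
    ∑ j ∈ Finset.range n, (j.choose (m - 1) : ℝ) * ((normalizer m p j)⁻¹ *
        (if y ≤ t * normalizer m p j then 0 else y))
      ≤ ((m - 1).factorial : ℝ)⁻¹ * (1 + 1 / (1 - 1 / p)) * t ^ (1 - p) * y ^ p := by
  have hp0 : 0 < p := by linarith
  rcases eq_or_lt_of_le hy with rfl | hy0
  · simp [Real.zero_rpow hp0.ne']
  have hm1 : (1 : ℝ) ≤ m := mod_cast Nat.one_le_iff_ne_zero.2 hm
  have hm0 : (0 : ℝ) < m := by linarith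
  have hp1 : 0 < 1 - 1 / p := by
    rw [sub_pos, div_lt_one hp0]; exact hp
  set b : ℝ := m - m / p with hb
  have hb1 : 1 - 1 / p ≤ b := by
    have : b = m * (1 - 1 / p) := by rw [hb]; ring
    rw [this]; nlinarith
  have hb0 : 0 < b := hp1.trans_le hb1
  set x : ℝ := (y / t) ^ (p / m) with hx
  have hx0 : 0 < x := by positivity
  have hcond : ∀ j : ℕ, t * normalizer m p j < y ↔ (j : ℝ) + 1 < x := fun j => by
    rw [mul_comm, ← lt_div_iff₀ ht, normalizer, hx,
      ← Real.lt_rpow_inv_iff_of_pos (by positivity) (by positivity) (by positivity), inv_div]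
  have hxb : x ^ b * y = t ^ (1 - p) * y ^ p := by
    have e : p / m * b = p - 1 := by rw [hb]; field_simp
    rw [hx, ← Real.rpow_mul (by positivity), e, Real.div_rpow hy ht.le,
      Real.rpow_sub_one hy0.ne', show 1 - p = -(p - 1) by ring, Real.rpow_neg ht.le]
    field_simp
  have hterm : ∀ j ∈ Finset.range n, (j.choose (m - 1) : ℝ) * ((normalizer m p j)⁻¹ *
        (if y ≤ t * normalizer m p j then 0 else y))
      ≤ (((m - 1).factorial : ℝ)⁻¹ * y) *
        (if (j : ℝ) + 1 < x then ((j : ℝ) + 1) ^ (b - 1) else 0) := fun j _ => by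
    by_cases h : (j : ℝ) + 1 < x
    · rw [if_neg (not_le.2 ((hcond j).2 h)), if_pos h]
      have h1 := choose_pred_le m j hm
      have e : ((j : ℝ) + 1) ^ (b - 1) = ((j : ℝ) + 1) ^ ((m : ℝ) - 1) * (normalizer m p j)⁻¹ := by
        rw [normalizer, ← Real.rpow_neg (by positivity), ← Real.rpow_add (by positivity)]
        congr 1; rw [hb]; ring
      rw [e]
      have := mul_le_mul_of_nonneg_right h1
        (mul_nonneg (inv_nonneg.2 (normalizer_pos m p j).le) hy)
      refine this.trans_eq ?_
      ring
    · rw [if_pos (not_lt.1 (mt (hcond j).1 h)), if_neg h]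
      simp
  refine (Finset.sum_le_sum hterm).trans ?_
  rw [← Finset.mul_sum]
  have h1 := sum_rpow_lt_le hb0 hx0.le n
  have h2 : 1 / b ≤ 1 / (1 - 1 / p) := one_div_le_one_div_of_le hp1 hb1
  have hfac : 0 < ((m - 1).factorial : ℝ)⁻¹ := by positivity
  calc _ ≤ (((m - 1).factorial : ℝ)⁻¹ * y) * ((1 + 1 / (1 - 1 / p)) * x ^ b) := by
        gcongr
        refine h1.trans ?_
        gcongr
    _ = ((m - 1).factorial : ℝ)⁻¹ * (1 + 1 / (1 - 1 / p)) * (x ^ b * y) := by ring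
    _ = _ := by rw [hxb]; ring

/-- The complementary range j+1 ≥ x, with terms of order (j+1)^(-a-1) for a = m(r/p - 1). Here p < r
gives convergence, and a ≥ r/p - 1 makes the bound uniform in m. -/
lemma sum_choose_mul_small_le {m : ℕ} (hm : m ≠ 0) {p r t y : ℝ} (hp : 1 < p) (hpr : p < r)
    (ht : 0 < t) (hy : 0 ≤ y) (n : ℕ) :
    ∑ j ∈ Finset.range n, (j.choose (m - 1) : ℝ) * ((normalizer m p j)⁻¹ ^ r *
        (if y ≤ t * normalizer m p j then y ^ r else 0))
      ≤ ((m - 1).factorial : ℝ)⁻¹ * (1 + 1 / (r / p - 1)) * t ^ (r - p) * y ^ p := by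
  have hp0 : 0 < p := by linarith
  rcases eq_or_lt_of_le hy with rfl | hy0
  · simp [Real.zero_rpow hp0.ne', Real.zero_rpow (by linarith : r ≠ 0)]
  have hm1 : (1 : ℝ) ≤ m := mod_cast Nat.one_le_iff_ne_zero.2 hm
  have hm0 : (0 : ℝ) < m := by linarith
  have hp1 : 0 < r / p - 1 := by
    rw [sub_pos, one_lt_div hp0]; exact hpr
  set a : ℝ := m * (r / p - 1) with ha
  have ha1 : r / p - 1 ≤ a := by nlinarith
  have ha0 : 0 < a := hp1.trans_le ha1
  set x : ℝ := (y / t) ^ (p / m) with hx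
  have hx0 : 0 < x := by positivity
  have hcond : ∀ j : ℕ, y ≤ t * normalizer m p j ↔ x ≤ (j : ℝ) + 1 := fun j => by
    rw [mul_comm, ← div_le_iff₀ ht, normalizer, hx,
      ← Real.rpow_inv_le_iff_of_pos (by positivity) (by positivity) (by positivity), inv_div]
  have hxa : x ^ (-a) * y ^ r = t ^ (r - p) * y ^ p := by
    have e : p / m * -a = -(r - p) := by rw [ha]; field_simp
    rw [hx, ← Real.rpow_mul (by positivity), e, Real.rpow_neg (by positivity),
      Real.div_rpow hy ht.le, Real.rpow_sub hy0]
    field_simp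
  have hterm : ∀ j ∈ Finset.range n, (j.choose (m - 1) : ℝ) * ((normalizer m p j)⁻¹ ^ r *
        (if y ≤ t * normalizer m p j then y ^ r else 0))
      ≤ (((m - 1).factorial : ℝ)⁻¹ * y ^ r) *
        (if x ≤ (j : ℝ) + 1 then ((j : ℝ) + 1) ^ (-a - 1) else 0) := fun j _ => by
    by_cases h : x ≤ (j : ℝ) + 1
    · rw [if_pos ((hcond j).2 h), if_pos h]
      have h1 := choose_pred_le m j hm
      have e : ((j : ℝ) + 1) ^ (-a - 1)
          = ((j : ℝ) + 1) ^ ((m : ℝ) - 1) * (normalizer m p j)⁻¹ ^ r := by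
        rw [normalizer, ← Real.rpow_neg (by positivity), ← Real.rpow_mul (by positivity),
          ← Real.rpow_add (by positivity)]
        congr 1; rw [ha]; ring
      rw [e]
      have h0 : 0 ≤ (normalizer m p j)⁻¹ := inv_nonneg.2 (normalizer_pos m p j).le
      have := mul_le_mul_of_nonneg_right h1
        (mul_nonneg (Real.rpow_nonneg h0 r) (Real.rpow_nonneg hy r))
      refine this.trans_eq ?_
      ring
    · rw [if_neg (mt (hcond j).1 h), if_neg h]
      simp
  refine (Finset.sum_le_sum hterm).trans ?_
  rw [← Finset.mul_sum]
  have h1 := sum_rpow_ge_le ha0 hx0 n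
  have h2 : 1 / a ≤ 1 / (r / p - 1) := one_div_le_one_div_of_le hp1 ha1
  have hfac : 0 < ((m - 1).factorial : ℝ)⁻¹ := by positivity
  calc _ ≤ (((m - 1).factorial : ℝ)⁻¹ * y ^ r) * ((1 + 1 / (r / p - 1)) * x ^ (-a)) := by
        gcongr
        refine h1.trans ?_
        gcongr
    _ = ((m - 1).factorial : ℝ)⁻¹ * (1 + 1 / (r / p - 1)) * (x ^ (-a) * y ^ r) := by ring
    _ = _ := by rw [hxa]; ring

/-- The function `h` truncated at the level `c`. -/
noncomputable def truncNorm {α B : Type*} [NormedAddCommGroup B] (h : α → B) (c : ℝ) : α → B :=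
  {y | ‖h y‖ ≤ c}.indicator h

lemma isBddMeasurable_truncNorm {α B : Type*} [MeasurableSpace α] [NormedAddCommGroup B]
    [MeasurableSpace B] [BorelSpace B] {h : α → B} (hh : Measurable h) (c : ℝ) :
    IsBddMeasurable (truncNorm h c) := by
  refine ⟨hh.indicator (measurableSet_le hh.norm measurable_const), max c 0, fun y => ?_⟩
  unfold truncNorm
  by_cases hy : ‖h y‖ ≤ c
  · rw [Set.indicator_of_mem (by exact hy)]; exact hy.trans (le_max_left _ _)
  · rw [Set.indicator_of_notMem (by exact hy), norm_zero]; exact le_max_right _ _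

lemma norm_truncNorm_rpow {α B : Type*} [NormedAddCommGroup B] (h : α → B) (c : ℝ) {r : ℝ}
    (hr : r ≠ 0) (y : α) : ‖truncNorm h c y‖ ^ r = if ‖h y‖ ≤ c then ‖h y‖ ^ r else 0 := by
  unfold truncNorm
  split_ifs with hy
  · rw [Set.indicator_of_mem (by exact hy)]
  · rw [Set.indicator_of_notMem (by exact hy), norm_zero, Real.zero_rpow hr]

lemma norm_sub_truncNorm {α B : Type*} [NormedAddCommGroup B] (h : α → B) (c : ℝ) (y : α) :
    ‖h y - truncNorm h c y‖ = if ‖h y‖ ≤ c then 0 else ‖h y‖ := by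
  unfold truncNorm
  split_ifs with hy
  · rw [Set.indicator_of_mem (by exact hy), sub_self, norm_zero]
  · rw [Set.indicator_of_notMem (by exact hy), sub_zero]

/-- A single term of the exponential series of uv. It absorbs a factor u for each of m-1 summation
indices and v for each of m recentrings. -/
lemma pow_pred_mul_pow_div_factorial_le {u v : ℝ} (hu : 0 ≤ u) (hv : 0 ≤ v) {m : ℕ}
    (hm : m ≠ 0) : u ^ (m - 1) * v ^ m * ((m - 1).factorial : ℝ)⁻¹ ≤ v * Real.exp (u * v) := by
  obtain ⟨k, rfl⟩ := Nat.exists_eq_succ_of_ne_zero hm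
  have := Real.pow_div_factorial_le_exp (u * v) (mul_nonneg hu hv) k
  rw [Nat.succ_sub_one, Nat.succ_eq_add_one]
  calc u ^ k * v ^ (k + 1) * (k.factorial : ℝ)⁻¹ = v * ((u * v) ^ k / k.factorial) := by
        rw [mul_pow]; ring
    _ ≤ _ := by gcongr

/-! ### Martingale part and summable remainder -/

section

variable {S B : Type*} [MeasurableSpace S] (P : Measure S) [IsProbabilityMeasure P] {m : ℕ}
  [NormedAddCommGroup B] [NormedSpace ℝ B] [CompleteSpace B] [MeasurableSpace B] [BorelSpace B]
  [SecondCountableTopology B] {φ : B → ℝ} {r κ c C : ℝ}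

/-- The normalized layers of a degenerate `U`-statistic are the sum of bounded martingale
differences and of an absolutely summable remainder. -/
theorem exists_layer_decomposition (hφ : IsSmoothGauge φ r κ c C) {p : ℝ} (hp : 1 < p)
    (hpr : p < r) (hm : m ≠ 0) {h : (Fin m → S) → B} (hh : Measurable h)
    (hint : Integrable h (iidMeasure (Fin m) P))
    (h0 : ∀ l, coordAvg P l h =ᵐ[iidMeasure (Fin m) P] 0)
    (hhp : Integrable (fun y => ‖h y‖ ^ p) (iidMeasure (Fin m) P)) {t : ℝ} (ht : 0 < t) :
    ∃ d e : ℕ → (ℕ → S) → B, IsBddMartingaleDiff P d ∧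
      (∀ j, Integrable (e j) (iidMeasure ℕ P)) ∧
      (∀ j x, (normalizer m p j)⁻¹ • layer h j x = d j x + e j x) ∧
      (∀ n, ∑ j ∈ Finset.range n, ∫ x, φ (d j x) ∂(iidMeasure ℕ P)
        ≤ C * (2 ^ r * Real.exp (κ * 2 ^ r)) * (1 + 1 / (r / p - 1)) * t ^ (r - p) *
          ∫ y, ‖h y‖ ^ p ∂(iidMeasure (Fin m) P)) ∧
      ∀ n, ∑ j ∈ Finset.range n, ∫ x, ‖e j x‖ ∂(iidMeasure ℕ P)
        ≤ (2 * Real.exp (1 * 2)) * (1 + 1 / (1 - 1 / p)) * t ^ (1 - p) *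
          ∫ y, ‖h y‖ ^ p ∂(iidMeasure (Fin m) P) := by
  have hr1 : 1 ≤ r := by linarith
  have hr0 : 0 < r := by linarith
  set ν := iidMeasure (Fin m) P
  set a := normalizer m p with ha
  have ha0 : ∀ j, 0 < a j := normalizer_pos m p
  have hai : ∀ j, 0 ≤ (a j)⁻¹ := fun j => inv_nonneg.2 (ha0 j).le
  have bT : ∀ j, IsBddMeasurable (truncNorm h (t * a j)) := fun j =>
    isBddMeasurable_truncNorm hh _
  -- Truncation alone destroys degeneracy; recentring in all m coordinates restores it exactly, not
  -- merely almost everywhere.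
  set G : ℕ → (Fin m → S) → B := fun j => centerList P (List.finRange m) (truncNorm h (t * a j))
  have bG : ∀ j, IsBddMeasurable (G j) := fun j => (bT j).centerList P _
  set g : ℕ → (Fin m → S) → B := fun j y => (a j)⁻¹ • G j y with hg
  have bg : ∀ j, IsBddMeasurable (g j) := fun j => (bG j).const_smul _
  have hg0 : ∀ j l x, coordAvg P l (g j) x = 0 := fun j l x => by
    have := coordAvg_centerList P (bT j) (List.finRange m) (List.mem_finRange l) x
    simp only [coordAvg] at this
    simp only [coordAvg, hg, G, integral_smul, this, smul_zero]
  set f : ℕ → (Fin m → S) → B := fun j y => (a j)⁻¹ • (h y - G j y) with hf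
  have hfi : ∀ j, Integrable (f j) ν := fun j => (hint.sub ((bG j).integrable ν)).smul _
  refine ⟨fun j => layer (g j) j, fun j => layer (f j) j, isBddMartingaleDiff_layer P bg hg0,
    fun j => integrable_layer P (hfi j) j, fun j x => ?_, fun n => ?_, fun n => ?_⟩
  · rw [← layer_smul, ← layer_add]
    congr 1
    funext y
    simp only [hg, hf, smul_sub, add_sub_cancel]
  · have hφg : ∀ j, ∫ y, φ (g j y) ∂ν
        ≤ C * ((2 ^ r) ^ m * ∫ y, (a j)⁻¹ ^ r * ‖truncNorm h (t * a j) y‖ ^ r ∂ν) := fun j => by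
      have h1 := integral_mono (((bg j).gauge hφ).integrable ν)
        ((((bg j).norm_rpow hr0.le).integrable ν).const_mul C) fun y => hφ.upper (g j y)
      have h2 := integral_norm_centerList_rpow_le P (bT j) (List.finRange m) hr1
      have e : ∀ y, ‖g j y‖ ^ r = (a j)⁻¹ ^ r * ‖G j y‖ ^ r := fun y => by
        rw [hg, norm_smul, Real.norm_of_nonneg (hai j), Real.mul_rpow (hai j) (norm_nonneg _)]
      rw [integral_const_mul] at h1
      simp only [e] at h1
      rw [integral_const_mul] at h1 ⊢
      rw [List.length_finRange] at h2
      refine h1.trans ?_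
      have h3 := mul_le_mul_of_nonneg_left h2 (Real.rpow_nonneg (hai j) r)
      refine (mul_le_mul_of_nonneg_left h3 hφ.C_pos.le).trans_eq ?_
      ring
    have hi : ∀ j, Integrable (fun y => (j.choose (m - 1) : ℝ) *
        ((a j)⁻¹ ^ r * ‖truncNorm h (t * a j) y‖ ^ r)) ν := fun j =>
      ((((bT j).norm_rpow hr0.le).integrable ν).const_mul _).const_mul _
    have hsum : ∑ j ∈ Finset.range n, (j.choose (m - 1) : ℝ) *
        ∫ y, (a j)⁻¹ ^ r * ‖truncNorm h (t * a j) y‖ ^ r ∂ν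
        ≤ ((m - 1).factorial : ℝ)⁻¹ * (1 + 1 / (r / p - 1)) * t ^ (r - p) *
          ∫ y, ‖h y‖ ^ p ∂ν := by
      simp only [← integral_const_mul]
      rw [← integral_finsetSum _ fun j _ => hi j]
      refine integral_mono (integrable_finsetSum _ fun j _ => hi j) (hhp.const_mul _) fun y => ?_
      simp only [norm_truncNorm_rpow h _ hr0.ne']
      exact sum_choose_mul_small_le hm hp hpr ht (norm_nonneg _) n
    have hA : 0 ≤ ∫ y, ‖h y‖ ^ p ∂ν := integral_nonneg fun y => by positivity
    have hq : 0 ≤ 1 + 1 / (r / p - 1) := by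
      have : 0 < r / p - 1 := by
        rw [sub_pos, one_lt_div (by linarith)]; exact hpr
      positivity
    calc _ ≤ ∑ j ∈ Finset.range n, (C * (κ ^ (m - 1) * (2 ^ r) ^ m)) * ((j.choose (m - 1) : ℝ) *
          ∫ y, (a j)⁻¹ ^ r * ‖truncNorm h (t * a j) y‖ ^ r ∂ν) := by
          refine Finset.sum_le_sum fun j _ => ?_
          refine (integral_gauge_layer_le P hφ hm (bg j) (hg0 j) j).trans ?_
          have := mul_le_mul_of_nonneg_left (hφg j) (pow_nonneg hφ.κ_pos.le (m - 1))
          refine (mul_le_mul_of_nonneg_left this (Nat.cast_nonneg _)).trans_eq ?_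
          ring
      _ ≤ (C * (κ ^ (m - 1) * (2 ^ r) ^ m)) * (((m - 1).factorial : ℝ)⁻¹ *
          (1 + 1 / (r / p - 1)) * t ^ (r - p) * ∫ y, ‖h y‖ ^ p ∂ν) := by
          rw [← Finset.mul_sum]
          have h1 := hφ.C_pos
          have h2 := hφ.κ_pos
          gcongr
      _ = C * (κ ^ (m - 1) * (2 ^ r) ^ m * ((m - 1).factorial : ℝ)⁻¹) *
          (1 + 1 / (r / p - 1)) * t ^ (r - p) * ∫ y, ‖h y‖ ^ p ∂ν := by ring
      _ ≤ _ := by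
          have h1 := hφ.C_pos
          have := pow_pred_mul_pow_div_factorial_le hφ.κ_pos.le
            (by positivity : (0 : ℝ) ≤ 2 ^ r) hm
          gcongr
  · have hfn : ∀ j, ∫ y, ‖f j y‖ ∂ν
        ≤ 2 ^ m * ∫ y, (a j)⁻¹ * ‖h y - truncNorm h (t * a j) y‖ ∂ν := fun j => by
      have h1 := integral_norm_sub_centerList_le P hint (bT j) (List.finRange m) fun k _ => h0 k
      rw [List.length_finRange] at h1
      simp only [hf, norm_smul, Real.norm_of_nonneg (hai j), integral_const_mul]
      refine (mul_le_mul_of_nonneg_left h1 (hai j)).trans_eq ?_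
      ring
    have hi : ∀ j, Integrable (fun y => (j.choose (m - 1) : ℝ) *
        ((a j)⁻¹ * ‖h y - truncNorm h (t * a j) y‖)) ν := fun j =>
      ((hint.sub ((bT j).integrable ν)).norm.const_mul _).const_mul _
    have hsum : ∑ j ∈ Finset.range n, (j.choose (m - 1) : ℝ) *
        ∫ y, (a j)⁻¹ * ‖h y - truncNorm h (t * a j) y‖ ∂ν
        ≤ ((m - 1).factorial : ℝ)⁻¹ * (1 + 1 / (1 - 1 / p)) * t ^ (1 - p) *
          ∫ y, ‖h y‖ ^ p ∂ν := by
      simp only [← integral_const_mul]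
      rw [← integral_finsetSum _ fun j _ => hi j]
      refine integral_mono (integrable_finsetSum _ fun j _ => hi j) (hhp.const_mul _) fun y => ?_
      simp only [norm_sub_truncNorm]
      exact sum_choose_mul_large_le hm hp ht (norm_nonneg _) n
    have hA : 0 ≤ ∫ y, ‖h y‖ ^ p ∂ν := integral_nonneg fun y => by positivity
    have hq : 0 ≤ 1 + 1 / (1 - 1 / p) := by
      have : 0 < 1 - 1 / p := by
        rw [sub_pos, div_lt_one (by linarith)]; exact hp
      positivity
    calc _ ≤ ∑ j ∈ Finset.range n, (2 : ℝ) ^ m * ((j.choose (m - 1) : ℝ) *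
          ∫ y, (a j)⁻¹ * ‖h y - truncNorm h (t * a j) y‖ ∂ν) := by
          refine Finset.sum_le_sum fun j _ => ?_
          refine (integral_norm_layer_le P hm ((hh.sub (bG j).1).const_smul _) (hfi j) j).trans ?_
          refine (mul_le_mul_of_nonneg_left (hfn j) (Nat.cast_nonneg _)).trans_eq ?_
          ring
      _ ≤ (2 : ℝ) ^ m * (((m - 1).factorial : ℝ)⁻¹ * (1 + 1 / (1 - 1 / p)) * t ^ (1 - p) *
          ∫ y, ‖h y‖ ^ p ∂ν) := by
          rw [← Finset.mul_sum]
          gcongr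
      -- No smoothness is used for the L¹ part, so u = 1 in the factorial bound, and v = 2 comes
      -- from recentring.
      _ = (1 ^ (m - 1) * 2 ^ m * ((m - 1).factorial : ℝ)⁻¹) * (1 + 1 / (1 - 1 / p)) *
          t ^ (1 - p) * ∫ y, ‖h y‖ ^ p ∂ν := by rw [one_pow]; ring
      _ ≤ _ := by
          have := pow_pred_mul_pow_div_factorial_le zero_le_one (zero_le_two : (0 : ℝ) ≤ 2) hm
          gcongr

end

/-! ### Summation by parts and Kronecker's lemma -/

/-- In Abel's formula the boundary term and the telescoping increments each have total weight at
most a(n-1). For n = 0, truncated subtraction reads the weight as a(0), which is harmless. -/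
lemma norm_sum_smul_le_of_monotone {B : Type*} [NormedAddCommGroup B] [NormedSpace ℝ B]
    {a : ℕ → ℝ} (ha : Monotone a) (ha0 : ∀ j, 0 ≤ a j) {v : ℕ → B} {δ : ℝ}
    (hv : ∀ n, ‖∑ j ∈ Finset.range n, v j‖ ≤ δ) (n : ℕ) :
    ‖∑ j ∈ Finset.range n, a j • v j‖ ≤ 2 * a (n - 1) * δ := by
  have hδ : 0 ≤ δ := (norm_nonneg _).trans (hv 0)
  rw [Finset.sum_range_by_parts]
  have h1 : ‖a (n - 1) • ∑ j ∈ Finset.range n, v j‖ ≤ a (n - 1) * δ := by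
    rw [norm_smul, Real.norm_of_nonneg (ha0 _)]
    exact mul_le_mul_of_nonneg_left (hv n) (ha0 _)
  have h2 : ‖∑ i ∈ Finset.range (n - 1), (a (i + 1) - a i) • ∑ j ∈ Finset.range (i + 1), v j‖
      ≤ a (n - 1) * δ := by
    calc _ ≤ ∑ i ∈ Finset.range (n - 1), (a (i + 1) - a i) * δ := by
          refine norm_sum_le_of_le _ fun i _ => ?_
          have : 0 ≤ a (i + 1) - a i := sub_nonneg.2 (ha i.le_succ)
          rw [norm_smul, Real.norm_of_nonneg this]
          exact mul_le_mul_of_nonneg_left (hv _) this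
      _ = (a (n - 1) - a 0) * δ := by rw [← Finset.sum_mul, Finset.sum_range_sub]
      _ ≤ _ := by
          gcongr
          linarith [ha0 0]
  calc _ ≤ _ := norm_sub_le _ _
    _ ≤ a (n - 1) * δ + a (n - 1) * δ := add_le_add h1 h2
    _ = _ := by ring

/-- Kronecker's lemma. -/
lemma tendsto_inv_mul_norm_sum_smul {B : Type*} [NormedAddCommGroup B] [NormedSpace ℝ B]
    {a : ℕ → ℝ} (ha : Monotone a) (ha0 : ∀ j, 0 < a j) (hat : Tendsto a atTop atTop) {v : ℕ → B}
    (hv : ∀ ε > 0, ∃ N, ∀ n, ‖∑ j ∈ Finset.range n, (if N ≤ j then v j else 0)‖ ≤ ε) :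
    Tendsto (fun n => (a (n - 1))⁻¹ * ‖∑ j ∈ Finset.range n, a j • v j‖) atTop (𝓝 0) := by
  have hnn : ∀ n, 0 ≤ (a (n - 1))⁻¹ * ‖∑ j ∈ Finset.range n, a j • v j‖ := fun n =>
    mul_nonneg (inv_nonneg.2 (ha0 _).le) (norm_nonneg _)
  refine Metric.tendsto_atTop.2 fun ε hε => ?_
  -- Summation by parts doubles ε/4 to ε/2; the other half is kept for the fixed initial segment.
  obtain ⟨N, hN⟩ := hv (ε / 4) (by positivity)
  set Z := ‖∑ j ∈ Finset.range N, a j • v j‖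
  have hlim : Tendsto (fun n => (a (n - 1))⁻¹ * Z) atTop (𝓝 0) := by
    simpa using ((hat.comp (tendsto_sub_atTop_nat 1)).inv_tendsto_atTop).mul_const Z
  obtain ⟨N', hN'⟩ := eventually_atTop.1 (hlim.eventually (gt_mem_nhds (half_pos hε)))
  refine ⟨max N N', fun n hn => ?_⟩
  rw [Real.dist_eq, sub_zero, abs_of_nonneg (hnn n)]
  have hsplit : ∑ j ∈ Finset.range n, a j • v j = ∑ j ∈ Finset.range N, a j • v j
      + ∑ j ∈ Finset.range n, a j • (if N ≤ j then v j else 0) := by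
    have : ∑ j ∈ Finset.range N, a j • v j
        = ∑ j ∈ Finset.range n, (if N ≤ j then 0 else a j • v j) := by
      rw [← Finset.sum_subset (Finset.range_mono (le_of_max_le_left hn)) fun j _ hj => by
        rw [if_pos (not_lt.1 (mt Finset.mem_range.2 hj))]]
      exact Finset.sum_congr rfl fun j hj => by rw [if_neg (not_le.2 (Finset.mem_range.1 hj))]
    rw [this, ← Finset.sum_add_distrib]
    refine Finset.sum_congr rfl fun j _ => ?_
    split_ifs <;> simp
  have h1 := norm_sum_smul_le_of_monotone ha (fun j => (ha0 j).le) hN n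
  have h2 := hN' n (le_of_max_le_right hn)
  have h3 : (a (n - 1))⁻¹ * ‖∑ j ∈ Finset.range n, a j • (if N ≤ j then v j else 0)‖ ≤ ε / 2 := by
    rw [inv_mul_le_iff₀ (ha0 _)]
    linarith
  rw [hsplit]
  calc _ ≤ (a (n - 1))⁻¹ * (Z + ‖∑ j ∈ Finset.range n, a j • (if N ≤ j then v j else 0)‖) := by
        gcongr
        · exact inv_nonneg.2 (ha0 _).le
        · exact norm_add_le _ _
    _ < ε := by rw [mul_add]; linarith

/-- The tails of a series with nonnegative terms and bounded partial sums. -/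
lemma exists_tail_bound {w : ℕ → ℝ} (hw : ∀ j, 0 ≤ w j) {W : ℝ}
    (hW : ∀ n, ∑ j ∈ Finset.range n, w j ≤ W) :
    ∃ R : ℕ → ℝ, Tendsto R atTop (𝓝 0) ∧
      ∀ N n, ∑ j ∈ Finset.range n, (if N ≤ j then w j else 0) ≤ R N := by
  have hs : Summable w := summable_of_sum_range_le hw hW
  refine ⟨fun N => ∑' j, w j - ∑ j ∈ Finset.range N, w j, ?_, fun N n => ?_⟩
  · simpa using hs.hasSum.tendsto_sum_nat.const_sub (∑' j, w j)
  · have h1 : ∑ j ∈ Finset.range n, (if N ≤ j then w j else 0) + ∑ j ∈ Finset.range N, w j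
        = ∑ j ∈ Finset.range (max n N), w j := by
      induction n with
      | zero => simp
      | succ n ih =>
        rw [Finset.sum_range_succ]
        split_ifs with h
        · rw [max_eq_left (by omega)] at ih ⊢
          rw [Finset.sum_range_succ, ← ih]; ring
        · rw [max_eq_right (by omega)] at ih ⊢
          rw [add_zero, ih]
    have h2 := hs.sum_le_tsum (Finset.range (max n N)) fun j _ => hw j
    linarith

/-! ### Maxima and tails of the decomposed series -/

lemma measure_exists_le_sum_norm {Ω B : Type*} [MeasurableSpace Ω] {μ : Measure Ω}
    [IsProbabilityMeasure μ] [NormedAddCommGroup B] {e : ℕ → Ω → B}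
    (he : ∀ j, Integrable (e j) μ) {W ε : ℝ} (hε : 0 < ε)
    (hW : ∀ n, ∑ j ∈ Finset.range n, ∫ x, ‖e j x‖ ∂μ ≤ W) :
    μ {x | ∃ n, ε ≤ ‖∑ j ∈ Finset.range n, e j x‖} ≤ ENNReal.ofReal (W / ε) := by
  have hE : {x | ∃ n, ε ≤ ‖∑ j ∈ Finset.range n, e j x‖}
      ⊆ ⋃ n : ℕ, {x | ε ≤ ∑ j ∈ Finset.range n, ‖e j x‖} := by
    rintro x ⟨n, hn⟩
    exact Set.mem_iUnion.2 ⟨n, hn.trans (norm_sum_le _ _)⟩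
  have hmono : Monotone fun n : ℕ => {x | ε ≤ ∑ j ∈ Finset.range n, ‖e j x‖} :=
    fun n k h x hx => le_trans hx (Finset.sum_le_sum_of_subset_of_nonneg (Finset.range_mono h)
      fun j _ _ => norm_nonneg _)
  refine (measure_mono hE).trans ?_
  rw [hmono.measure_iUnion]
  refine iSup_le fun n => ?_
  have h1 := mul_meas_ge_le_integral_of_nonneg (μ := μ)
    (f := fun x => ∑ j ∈ Finset.range n, ‖e j x‖)
    (ae_of_all _ fun x => Finset.sum_nonneg fun j _ => norm_nonneg _)
    (integrable_finsetSum _ fun j _ => (he j).norm) ε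
  rw [integral_finsetSum _ fun j _ => (he j).norm] at h1
  rw [← ofReal_measureReal]
  refine ENNReal.ofReal_le_ofReal ?_
  rw [le_div_iff₀ hε, mul_comm]
  exact h1.trans (hW n)

lemma setOf_exists_le_norm_sum_subset {Ω B : Type*} [NormedAddCommGroup B] {v d e : ℕ → Ω → B}
    (hv : ∀ j x, v j x = d j x + e j x) (ε : ℝ) :
    {x | ∃ n, ε ≤ ‖∑ j ∈ Finset.range n, v j x‖}
      ⊆ {x | ∃ n, ε / 2 ≤ ‖∑ j ∈ Finset.range n, d j x‖}
        ∪ {x | ∃ n, ε / 2 ≤ ‖∑ j ∈ Finset.range n, e j x‖} := by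
  rintro x ⟨n, hn⟩
  by_contra h
  simp only [Set.mem_union, Set.mem_ofPred_eq, not_or, not_exists, not_le] at h
  have h1 := h.1 n
  have h2 := h.2 n
  simp only [hv, Finset.sum_add_distrib] at hn
  linarith [norm_add_le (∑ j ∈ Finset.range n, d j x) (∑ j ∈ Finset.range n, e j x)]

section

variable {S B : Type*} [MeasurableSpace S] {P : Measure S} [IsProbabilityMeasure P]
  [NormedAddCommGroup B] [NormedSpace ℝ B] [CompleteSpace B] [MeasurableSpace B] [BorelSpace B]
  [SecondCountableTopology B] {φ : B → ℝ} {r κ c C : ℝ} {v d e : ℕ → (ℕ → S) → B}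

lemma measure_exists_le_norm_sum_add (hφ : IsSmoothGauge φ r κ c C)
    (hd : IsBddMartingaleDiff P d) (he : ∀ j, Integrable (e j) (iidMeasure ℕ P))
    (hv : ∀ j x, v j x = d j x + e j x) {W W' ε : ℝ} (hε : 0 < ε)
    (hW : ∀ n, ∑ j ∈ Finset.range n, ∫ x, φ (d j x) ∂(iidMeasure ℕ P) ≤ W)
    (hW' : ∀ n, ∑ j ∈ Finset.range n, ∫ x, ‖e j x‖ ∂(iidMeasure ℕ P) ≤ W') :
    iidMeasure ℕ P {x | ∃ n, ε ≤ ‖∑ j ∈ Finset.range n, v j x‖}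
      ≤ ENNReal.ofReal (κ * W / (c * (ε / 2) ^ r) + W' / (ε / 2)) := by
  have hW0 : 0 ≤ W := by simpa using hW 0
  have hW0' : 0 ≤ W' := by simpa using hW' 0
  have h1 := hφ.κ_pos
  have h2 := hφ.c_pos
  rw [ENNReal.ofReal_add (by positivity) (by positivity)]
  refine (measure_mono (setOf_exists_le_norm_sum_subset hv ε)).trans ((measure_union_le _ _).trans
    (add_le_add ?_ ?_))
  · exact hd.measure_exists_le hφ (half_pos hε) hW
  · exact measure_exists_le_sum_norm he (half_pos hε) hW'

/-- The maximal bound applies to the series started at N, with tail sums in place of W and W'. These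
tend to 0, so failure of smallness for every N has probability zero. -/
lemma ae_forall_exists_norm_tail_le (hφ : IsSmoothGauge φ r κ c C)
    (hd : IsBddMartingaleDiff P d) (he : ∀ j, Integrable (e j) (iidMeasure ℕ P))
    (hv : ∀ j x, v j x = d j x + e j x) {W W' : ℝ}
    (hW : ∀ n, ∑ j ∈ Finset.range n, ∫ x, φ (d j x) ∂(iidMeasure ℕ P) ≤ W)
    (hW' : ∀ n, ∑ j ∈ Finset.range n, ∫ x, ‖e j x‖ ∂(iidMeasure ℕ P) ≤ W') :
    ∀ᵐ x ∂(iidMeasure ℕ P), ∀ ε > 0, ∃ N, ∀ n,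
      ‖∑ j ∈ Finset.range n, (if N ≤ j then v j x else 0)‖ ≤ ε := by
  obtain ⟨R, hR, hRW⟩ := exists_tail_bound (fun j => integral_nonneg fun x => hφ.nonneg _) hW
  obtain ⟨R', hR', hRW'⟩ := exists_tail_bound (fun j => integral_nonneg fun x => norm_nonneg _) hW'
  have key : ∀ ε > 0, ∀ᵐ x ∂(iidMeasure ℕ P), ∃ N, ∀ n,
      ‖∑ j ∈ Finset.range n, (if N ≤ j then v j x else 0)‖ < ε := by
    intro ε hε
    -- The event on the left does not involve the outer N: it lies in the bad event of every tail.
    have hbound : ∀ N, iidMeasure ℕ P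
        {x | ¬ ∃ N, ∀ n, ‖∑ j ∈ Finset.range n, (if N ≤ j then v j x else 0)‖ < ε}
        ≤ ENNReal.ofReal (κ * R N / (c * (ε / 2) ^ r) + R' N / (ε / 2)) := fun N => by
      refine (measure_mono fun x hx => ?_).trans (measure_exists_le_norm_sum_add
        (v := fun j x => if N ≤ j then v j x else 0)
        (e := fun j x => if N ≤ j then e j x else 0) hφ (hd.tail N) (fun j => ?_)
        (fun j x => ?_) hε (fun n => ?_) fun n => ?_)
      · simp only [Set.mem_ofPred_eq, not_exists, not_forall, not_lt] at hx
        exact hx N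
      · by_cases h : N ≤ j
        · simpa [h] using he j
        · simp [h]
      · split_ifs <;> simp [hv]
      · refine (Finset.sum_le_sum fun j _ => le_of_eq ?_).trans (hRW N n)
        by_cases h : N ≤ j <;> simp [h, hφ.map_zero]
      · refine (Finset.sum_le_sum fun j _ => le_of_eq ?_).trans (hRW' N n)
        by_cases h : N ≤ j <;> simp [h]
    have hlim : Tendsto (fun N => ENNReal.ofReal (κ * R N / (c * (ε / 2) ^ r) + R' N / (ε / 2)))
        atTop (𝓝 0) := by
      rw [← ENNReal.ofReal_zero]
      refine ENNReal.tendsto_ofReal ?_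
      simpa using ((hR.const_mul κ).div_const (c * (ε / 2) ^ r)).add (hR'.div_const (ε / 2))
    exact le_antisymm (ge_of_tendsto' hlim hbound) zero_le
  have hall : ∀ᵐ x ∂(iidMeasure ℕ P), ∀ k : ℕ, ∃ N, ∀ n,
      ‖∑ j ∈ Finset.range n, (if N ≤ j then v j x else 0)‖ < 1 / ((k : ℝ) + 1) :=
    ae_all_iff.2 fun k => key _ (by positivity)
  filter_upwards [hall] with x hx ε hε
  obtain ⟨k, hk⟩ := exists_nat_one_div_lt hε
  obtain ⟨N, hN⟩ := hx k
  exact ⟨N, fun n => ((hN n).trans hk).le⟩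

end

/-! ### The two conclusions on sequence space -/

lemma monotone_normalizer (m : ℕ) {p : ℝ} (hp : 0 < p) : Monotone (normalizer m p) := by
  intro i j hij
  unfold normalizer
  gcongr

lemma tendsto_normalizer {m : ℕ} (hm : m ≠ 0) {p : ℝ} (hp : 0 < p) :
    Tendsto (normalizer m p) atTop atTop := by
  have hm0 : (0 : ℝ) < m := by positivity
  exact (tendsto_rpow_atTop (div_pos hm0 hp)).comp
    (tendsto_atTop_add_const_right _ _ tendsto_natCast_atTop_atTop)

lemma normalizer_pred (m : ℕ) (p : ℝ) {n : ℕ} (hn : n ≠ 0) :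
    normalizer m p (n - 1) = (n : ℝ) ^ ((m : ℝ) / p) := by
  rw [normalizer, Nat.cast_sub (Nat.one_le_iff_ne_zero.2 hn), Nat.cast_one, sub_add_cancel]

lemma sum_layer_eq_sum_smul {S B : Type*} [AddCommGroup B] [Module ℝ B] {m : ℕ} (p : ℝ)
    (h : (Fin m → S) → B) (n : ℕ) (x : ℕ → S) :
    ∑ j ∈ Finset.range n, layer h j x
      = ∑ j ∈ Finset.range n, normalizer m p j • (normalizer m p j)⁻¹ • layer h j x :=
  Finset.sum_congr rfl fun j _ => (smul_inv_smul₀ (normalizer_pos m p j).ne' _).symm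

section

variable {S B : Type*} [MeasurableSpace S] (P : Measure S) [IsProbabilityMeasure P] {m : ℕ}
  [NormedAddCommGroup B] [NormedSpace ℝ B] [CompleteSpace B] [MeasurableSpace B] [BorelSpace B]
  [SecondCountableTopology B] {φ : B → ℝ} {r κ c C : ℝ}

/-- Weak-type bound on sequence space. -/
theorem measure_exists_lt_normalized_sum_layer_le (hφ : IsSmoothGauge φ r κ c C) {p : ℝ}
    (hp : 1 < p) (hpr : p < r) (hm : m ≠ 0) {h : (Fin m → S) → B} (hh : Measurable h)
    (hint : Integrable h (iidMeasure (Fin m) P))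
    (h0 : ∀ l, coordAvg P l h =ᵐ[iidMeasure (Fin m) P] 0)
    (hhp : Integrable (fun y => ‖h y‖ ^ p) (iidMeasure (Fin m) P)) {t : ℝ} (ht : 0 < t) :
    iidMeasure ℕ P {x | ∃ n, m ≤ n ∧
        t < 1 / (n : ℝ) ^ ((m : ℝ) / p) * ‖∑ j ∈ Finset.range n, layer h j x‖}
      ≤ ENNReal.ofReal ((κ * (C * (2 ^ r * Real.exp (κ * 2 ^ r)) * (1 + 1 / (r / p - 1))) *
          8 ^ r / c + 8 * ((2 * Real.exp (1 * 2)) * (1 + 1 / (1 - 1 / p)))) * (t ^ p)⁻¹ *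
          ∫ y, ‖h y‖ ^ p ∂(iidMeasure (Fin m) P)) := by
  -- Truncating at the same t as the level makes both t^(r-p)/t^r and t^(1-p)/t equal to t^(-p).
  obtain ⟨d, e, hd, he, hv, hW, hW'⟩ :=
    exists_layer_decomposition P hφ hp hpr hm hh hint h0 hhp ht
  -- If all normalized partial sums stay below t/4, summation by parts gives at most t/2 < t.
  -- Halving t/4 between the two parts of the decomposition produces the 8^r and the 8.
  refine (measure_mono ?_).trans ((measure_exists_le_norm_sum_add hφ hd he hv
    (by positivity : 0 < t / 4) hW hW').trans_eq ?_)
  · rintro x ⟨n, hmn, hn⟩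
    by_contra hcon
    simp only [Set.mem_ofPred_eq, not_exists, not_le] at hcon
    have h1 := norm_sum_smul_le_of_monotone (monotone_normalizer m (by linarith))
      (fun j => (normalizer_pos m p j).le) (fun k => (hcon k).le) n
    rw [← sum_layer_eq_sum_smul, normalizer_pred m p (by omega)] at h1
    have hn0 : (0 : ℝ) < n := by
      have : 0 < n := by omega
      exact_mod_cast this
    have hpos : 0 < (n : ℝ) ^ ((m : ℝ) / p) := by positivity
    rw [one_div, lt_inv_mul_iff₀ hpos] at hn
    nlinarith
  · congr 1
    have hcp := hφ.c_pos
    have e1 : (t / 4 / 2) ^ r = t ^ r / 8 ^ r := by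
      rw [div_div, Real.div_rpow ht.le (by norm_num)]; norm_num
    rw [e1, Real.rpow_sub ht, Real.rpow_sub ht, Real.rpow_one]
    field_simp
    ring

theorem ae_tendsto_normalized_sum_layer (hφ : IsSmoothGauge φ r κ c C) {p : ℝ}
    (hp : 1 < p) (hpr : p < r) (hm : m ≠ 0) {h : (Fin m → S) → B} (hh : Measurable h)
    (hint : Integrable h (iidMeasure (Fin m) P))
    (h0 : ∀ l, coordAvg P l h =ᵐ[iidMeasure (Fin m) P] 0)
    (hhp : Integrable (fun y => ‖h y‖ ^ p) (iidMeasure (Fin m) P)) :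
    ∀ᵐ x ∂(iidMeasure ℕ P), Tendsto (fun n : ℕ => 1 / (n : ℝ) ^ ((m : ℝ) / p) *
      ‖∑ j ∈ Finset.range n, layer h j x‖) atTop (𝓝 0) := by
  -- Only finiteness of the two series matters here, so the truncation scale is fixed at 1.
  obtain ⟨d, e, hd, he, hv, hW, hW'⟩ :=
    exists_layer_decomposition P hφ hp hpr hm hh hint h0 hhp one_pos
  filter_upwards [ae_forall_exists_norm_tail_le hφ hd he hv hW hW'] with x hx
  refine (tendsto_inv_mul_norm_sum_smul (monotone_normalizer m (by linarith))
    (normalizer_pos m p) (tendsto_normalizer hm (by linarith)) hx).congr' ?_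
  filter_upwards [eventually_ne_atTop 0] with n hn
  rw [← sum_layer_eq_sum_smul, normalizer_pred m p hn, one_div]

end

/-! ### Transfer to an arbitrary i.i.d. sequence -/

section

variable {Ω S B : Type*} [MeasurableSpace Ω] [MeasurableSpace S] {μ : Measure Ω}
  [IsProbabilityMeasure μ] {ξ : ℕ → Ω → S}

lemma IsIIDSequence.isProbabilityMeasure_map (hξ : IsIIDSequence ξ μ) :
    IsProbabilityMeasure (μ.map (ξ 0)) :=
  Measure.isProbabilityMeasure_map (hξ.measurable 0).aemeasurable

lemma IsIIDSequence.measurePreserving (hξ : IsIIDSequence ξ μ) :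
    MeasurePreserving (fun ω i => ξ i ω) μ (iidMeasure ℕ (μ.map (ξ 0))) := by
  refine ⟨measurable_pi_iff.2 hξ.measurable, ?_⟩
  rw [hξ.indep.map_fun_eq_infinitePi_map hξ.measurable]
  simp only [fun i => (hξ.identDistrib i).map_eq]

lemma IsIIDSequence.measurePreserving_fin (hξ : IsIIDSequence ξ μ) (m : ℕ) :
    MeasurePreserving (fun ω (l : Fin m) => ξ l ω) μ (iidMeasure (Fin m) (μ.map (ξ 0))) := by
  have := hξ.isProbabilityMeasure_map
  have h : MeasurePreserving (fun (x : ℕ → S) (l : Fin m) => x l) (iidMeasure ℕ (μ.map (ξ 0)))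
      (iidMeasure (Fin m) (μ.map (ξ 0))) :=
    ⟨by fun_prop, Measure.map_infinitePi_infinitePi_of_inj Fin.val_injective⟩
  exact h.comp hξ.measurePreserving

variable [NormedAddCommGroup B] [NormedSpace ℝ B] [CompleteSpace B] [MeasurableSpace B]
  [BorelSpace B] [SecondCountableTopology B] {m : ℕ} {h : (Fin m → S) → B}

/-- By independence, averaging h over coordinate l is a version of the conditional expectation given
the other variables. Degeneracy thus becomes a statement about the product law alone. -/
lemma IsDegenerated.coordAvg_ae_eq_zero (hξ : IsIIDSequence ξ μ) (hh : Measurable h)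
    (hdeg : IsDegenerated h ξ μ) (l : Fin m) :
    coordAvg (μ.map (ξ 0)) l h =ᵐ[iidMeasure (Fin m) (μ.map (ξ 0))] 0 := by
  have := hξ.isProbabilityMeasure_map
  set P := μ.map (ξ 0)
  have hY := hξ.measurePreserving_fin m
  set Y : Ω → Fin m → S := fun ω l => ξ l ω with hYdef
  have hint : Integrable h (iidMeasure (Fin m) P) :=
    (hY.integrable_comp hh.stronglyMeasurable.aestronglyMeasurable).1 hdeg.1
  have hce : (fun ω => coordAvg P l h (Y ω)) =ᵐ[μ] μ[kernelRV h ξ | sigmaWithout ξ l] := by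
    have hR : Measurable fun ω (k : {k : Fin m // k ≠ l}) => ξ (k : Fin m) ω :=
      measurable_pi_iff.2 fun k => hξ.measurable _
    refine ae_eq_condExp_of_forall_setIntegral_eq hR.comap_le hdeg.1 (fun s _ _ => ?_)
      (fun s hs _ => ?_) ?_
    · exact ((hY.integrable_comp (integrable_coordAvg P l hint).1).2
        (integrable_coordAvg P l hint)).integrableOn
    · obtain ⟨T, hT, rfl⟩ := hs
      set ρ : (Fin m → S) → {k : Fin m // k ≠ l} → S := fun y k => y k
      have hρ : Measurable ρ := by fun_prop
      have hinv : ∀ x s, ρ (Function.update x l s) = ρ x := fun x s => by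
        funext k
        exact Function.update_of_ne k.2 _ _
      have h1 := setIntegral_map (μ := μ) (g := Y) (hρ hT)
        (by rw [hY.map_eq]; exact (integrable_coordAvg P l hint).1) hY.aemeasurable
      have h2 := setIntegral_map (μ := μ) (g := Y) (hρ hT)
        (by rw [hY.map_eq]; exact hint.1) hY.aemeasurable
      rw [hY.map_eq, ← integral_indicator (hρ hT)] at h1 h2
      -- An event in the other coordinates is unaffected by updating l, so its indicator commutes
      -- with the average.
      have h3 : (ρ ⁻¹' T).indicator (coordAvg P l h) = coordAvg P l ((ρ ⁻¹' T).indicator h) := by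
        funext x
        by_cases hx : ρ x ∈ T <;> simp [coordAvg, Set.indicator, hinv, hx]
      rw [h3, integral_coordAvg P l (hint.indicator (hρ hT)), h2] at h1
      exact h1.symm
    -- Rebuilding a point from its other coordinates and a separate l-th value exhibits the average
    -- as a measurable function of the other variables only.
    · set glue : ({k : Fin m // k ≠ l} → S) × S → Fin m → S :=
        fun q k => if hk : k = l then q.2 else q.1 ⟨k, hk⟩
      have hglue : Measurable glue := by
        refine measurable_pi_iff.2 fun k => ?_
        by_cases hk : k = l
        · simp only [glue, hk, dif_pos]; fun_prop
        · simp only [glue, hk, dif_neg, not_false_eq_true]; fun_prop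
      have hH := (hh.comp hglue).stronglyMeasurable.integral_prod_right' (ν := P)
      have e : (fun ω => coordAvg P l h (Y ω)) = fun ω =>
          (fun z => ∫ s, (h ∘ glue) (z, s) ∂P) fun (k : {k : Fin m // k ≠ l}) =>
            ξ (k : Fin m) ω := by
        funext ω
        simp only [coordAvg, Function.comp]
        congr 1
        funext s
        congr 1
        funext k
        by_cases hk : k = l
        · subst hk; simp [glue]
        · simp [glue, hk, Y]
      rw [e]
      exact (hH.comp_measurable (comap_measurable _)).aestronglyMeasurable
  have hmeas : MeasurableSet {y | coordAvg P l h y = (0 : (Fin m → S) → B) y} :=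
    measurable_coordAvg P l hh (measurableSet_singleton 0)
  rw [← hY.map_eq]
  exact (ae_map_iff hY.aemeasurable hmeas).2 (hce.trans (hdeg.2 l))

end

theorem mainTheorem5 {B : Type*} [NormedAddCommGroup B] [NormedSpace ℝ B] [CompleteSpace B]
    [TopologicalSpace.SeparableSpace B] [MeasurableSpace B] [BorelSpace B]
    (r : ℝ) (hr₁ : 1 < r) (hr₂ : r ≤ 2) (hB : IsRSmooth B r)
    (p : ℝ) (hp₁ : 1 < p) (hpr : p < r) :
    ∃ K : ℝ, 0 < K ∧
      ∀ (m : ℕ), 2 ≤ m →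
      ∀ (Ω : Type*) [MeasurableSpace Ω] (μ : Measure Ω) [IsProbabilityMeasure μ]
        (S : Type*) [MeasurableSpace S]
        (ξ : ℕ → Ω → S) (h : (Fin m → S) → B),
        IsIIDSequence ξ μ → Measurable h → IsDegenerated h ξ μ →
        (⨆ (t : ℝ) (_ : 0 < t), ENNReal.ofReal (t ^ p) *
            μ {ω | ENNReal.ofReal t <
              ⨆ (n : ℕ) (_ : m ≤ n),
                ENNReal.ofReal (1 / (n : ℝ) ^ ((m : ℝ) / p) * ‖uStat h ξ n ω‖)}
          ≤ ENNReal.ofReal K * ∫⁻ ω, ‖kernelRV h ξ ω‖ₑ ^ p ∂μ) ∧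
        (∫⁻ ω, ‖kernelRV h ξ ω‖ₑ ^ p ∂μ < ⊤ →
          ∀ᵐ ω ∂μ, Tendsto
            (fun n : ℕ => 1 / (n : ℝ) ^ ((m : ℝ) / p) * ‖uStat h ξ n ω‖) atTop (𝓝 0)) := by
  have : SecondCountableTopology B := UniformSpace.secondCountable_of_separable B
  obtain ⟨φ, κ, c, C, hφ⟩ := hB.exists_gauge hr₁ hr₂
  have hp0 : 0 < p := by linarith
  set K : ℝ := κ * (C * (2 ^ r * Real.exp (κ * 2 ^ r)) * (1 + 1 / (r / p - 1))) * 8 ^ r / c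
          + 8 * ((2 * Real.exp (1 * 2)) * (1 + 1 / (1 - 1 / p))) with hKdef
  have hK : 0 < K := by
    have h1 : 0 < r / p - 1 := by rw [sub_pos, one_lt_div hp0]; exact hpr
    have h2 : 0 < 1 - 1 / p := by rw [sub_pos, div_lt_one hp0]; exact hp₁
    have h3 := hφ.κ_pos
    have h4 := hφ.C_pos
    have h5 := hφ.c_pos
    positivity
  refine ⟨K, hK, fun m hm Ω _ μ _ S _ ξ h hξ hh hdeg => ?_⟩
  have hm0 : m ≠ 0 := by omega
  have := hξ.isProbabilityMeasure_map
  have h0 := hdeg.coordAvg_ae_eq_zero hξ hh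
  have hX := hξ.measurePreserving
  have hY := hξ.measurePreserving_fin m
  set P := μ.map (ξ 0)
  have hint : Integrable h (iidMeasure (Fin m) P) :=
    (hY.integrable_comp hh.stronglyMeasurable.aestronglyMeasurable).1 hdeg.1
  have hlint : ∫⁻ ω, ‖kernelRV h ξ ω‖ₑ ^ p ∂μ
      = ∫⁻ y, ENNReal.ofReal (‖h y‖ ^ p) ∂(iidMeasure (Fin m) P) := by
    have e : ∀ y, ENNReal.ofReal (‖h y‖ ^ p) = ‖h y‖ₑ ^ p := fun y => by
      rw [← ENNReal.ofReal_rpow_of_nonneg (norm_nonneg _) hp0.le, ofReal_norm]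
    simp only [e]
    exact hY.lintegral_comp (hh.enorm.pow_const p)
  have hhp : ∫⁻ ω, ‖kernelRV h ξ ω‖ₑ ^ p ∂μ < ⊤ →
      Integrable (fun y => ‖h y‖ ^ p) (iidMeasure (Fin m) P) := fun hfin => by
    refine ⟨(hh.norm.pow_const p).stronglyMeasurable.aestronglyMeasurable, ?_⟩
    rw [hasFiniteIntegral_iff_ofReal (ae_of_all _ fun y => by positivity), ← hlint]
    exact hfin
  have hU : ∀ n ω, uStat h ξ n ω = ∑ j ∈ Finset.range n, layer h j fun i => ξ i ω :=
    uStat_eq_sum_layer hm0 h ξ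
  simp only [hU]
  refine ⟨iSup₂_le fun t ht => ?_, fun hfin => ?_⟩
  -- For an infinite moment the right-hand side is ⊤, because K > 0.
  · rcases eq_or_lt_of_le (le_top (a := ∫⁻ ω, ‖kernelRV h ξ ω‖ₑ ^ p ∂μ)) with htop | hfin
    · rw [htop, ENNReal.mul_top (by simpa using hK)]
      exact le_top
    have hbound := measure_exists_lt_normalized_sum_layer_le P hφ hp₁ hpr hm0 hh hint h0
      (hhp hfin) ht
    have hsub : {ω | ENNReal.ofReal t < ⨆ (n : ℕ) (_ : m ≤ n),
        ENNReal.ofReal (1 / (n : ℝ) ^ ((m : ℝ) / p) *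
          ‖∑ j ∈ Finset.range n, layer h j fun i => ξ i ω‖)}
        ⊆ (fun ω i => ξ i ω) ⁻¹' {x | ∃ n, m ≤ n ∧
          t < 1 / (n : ℝ) ^ ((m : ℝ) / p) * ‖∑ j ∈ Finset.range n, layer h j x‖} := by
      intro ω hω
      rw [Set.mem_ofPred_eq] at hω
      obtain ⟨n, hn⟩ := lt_iSup_iff.1 hω
      obtain ⟨hmn, hn⟩ := lt_iSup_iff.1 hn
      exact ⟨n, hmn, (ENNReal.ofReal_lt_ofReal_iff'.1 hn).1⟩
    -- This inequality holds for every set, so measurability of the event need not be checked.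
    have hmap := Measure.le_map_apply hX.aemeasurable {x | ∃ n, m ≤ n ∧
          t < 1 / (n : ℝ) ^ ((m : ℝ) / p) * ‖∑ j ∈ Finset.range n, layer h j x‖}
    rw [hX.map_eq] at hmap
    have htp : 0 < t ^ p := Real.rpow_pos_of_pos ht p
    calc _ ≤ ENNReal.ofReal (t ^ p) * ENNReal.ofReal (K * (t ^ p)⁻¹ *
          ∫ y, ‖h y‖ ^ p ∂(iidMeasure (Fin m) P)) := by
          gcongr
          exact (measure_mono hsub).trans (hmap.trans hbound)
      _ = ENNReal.ofReal (K * ∫ y, ‖h y‖ ^ p ∂(iidMeasure (Fin m) P)) := by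
          rw [← ENNReal.ofReal_mul htp.le]
          congr 1
          field_simp
      _ = _ := by
          rw [ENNReal.ofReal_mul hK.le, hlint, ofReal_integral_eq_lintegral_ofReal (hhp hfin)
            (ae_of_all _ fun y => by positivity)]
  · exact hX.quasiMeasurePreserving.ae
      (ae_tendsto_normalized_sum_layer P hφ hp₁ hpr hm0 hh hint h0 (hhp hfin))
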